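/- **Setting.** Let $\Xi\subseteq\mathbb R^M$ carry a metric $\rho$ (with its Borel $\sigma$-algebra), and let $\Pi$ be a probability measure (the prior) on $\Xi$. There are $K\ge 1$ clients ($K$ fixed), each with the same number $s$ of observations; client $k$ has data $D_k=(D_{k1},\dots,D_{ks})$. Under the parameter $\theta\in\Xi$ all observations are independent and $D_{ki}$ has density $p_{ki}(\cdot\mid\theta)$ (which may depend on $k$, $i$ and also on $s$), jointly measurable in $(\theta,y)$, with respect to a fixed $\sigma$-finite measure $\nu$ on the sample space. Let $P^{(S)}_{\theta_0}$ be the joint law of the $S=Ks$ observations under $\theta_0\in\Xi$. The client posteriors are $$p(\mathrm d\theta\mid D_k)=\frac{\prod_{i=1}^s p_{ki}(D_{ki}\mid\theta)\,\Pi(\mathrm d\theta)}{\int_\Xi\prod_{i=1}^s p_{ki}(D_{ki}\mid\theta')\,\Pi(\mathrm d\theta')}.$$ For functions $f,g\ge0$ put $h(f,g)=\big(\int(\sqrt f-\sqrt g)^2\,d\nu\big)^{1/2}$; for $s$-tuples of such functions put $h_s(f,g)=\big(\frac1s\sum_{i=1}^s h^2(f_i,g_i)\big)^{1/2}$, and write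 $h_{sk}(\theta,\theta')=h_s\big((p_{ki}(\cdot\mid\theta))_{i\le s},(p_{ki}(\cdot\mid\theta'))_{i\le s}\big)$ (pseudo Hellinger distance). For a class $\mathcal F$ of $s$-tuples of densities, $H_{[]}(u,\mathcal F)$ is the logarithm of the least number of brackets $[l,U]$ ($s$-tuples of nonnegative measurable functions with $h_s(l,U)\le u$) such that every $f\in\mathcal F$ satisfies $l_i\le f_i\le U_i$ $\nu$-a.e. for all $i$, for one of the brackets. The distance $W_2$ on probability measures on $\Xi$ is $W_2^2(\mu,\mu')=\inf_\pi\int\rho^2(x,x')\,\pi(\mathrm dx,\mathrm dx')$ over couplings $\pi$ of $\mu,\mu'$, and a $W_2$ barycenter of $\mu_1,\dots,\mu_K$ is a minimizer over probability measures $q$ on $\Xi$ of $\frac1K\sum_{k=1}^K W_2^2(q,\mu_k)$. **Theorem 5.2.** Assume: 1. $\Xi$ is compact in the metric $\rho$, and $\theta_0$ is an interior point of $\Xi$ in $\mathbb R^M$. 2. There are $\alpha>0$ and $C_L>0$ such that, for all sufficiently large $s$, all $k$ and all $\theta,\theta'\in\Xi$: $h_{sk}^2(\theta,\theta')\ge C_L\,\rho^{2\alpha}(\theta,\theta')$.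 3. There are $C_1>0$, $0<C_2<C_1^2/2^{12}$ and a function $\Psi(u,r)>0$ ($u,r>0$), non-increasing in $u$ and non-decreasing in $r$, such that for all sufficiently large $s$: for all $k$ and all $u,r>0$, $$H_{[]}\big(u,\{(p_{ki}(\cdot\mid\theta))_{i\le s}:\theta\in\Xi,\ h_{sk}(\theta,\theta_0)\le r\}\big)\le\Psi(u,r),$$ and for all $r\ge \log s/\sqrt s$, $$\int_{C_1r^2/2^{12}}^{C_1r}\sqrt{\Psi(u,r)}\,du<C_2\sqrt s\,r^2 .$$ 4. There are $\kappa,c_\pi>0$ such that, for all sufficiently large $s$ and all $k$, $$\Pi\Big(\theta\in\Xi:\ \frac1s\sum_{i=1}^s\mathbb E_{P_{\theta_0}}\exp\Big(\kappa\log_+\frac{p_{ki}(D_{ki}\mid\theta_0)}{p_{ki}(D_{ki}\mid\theta)}\Big)-1\le\frac{\log^2 s}{s}\Big)\ge\exp(-c_\pi K\log^2 s),$$ where $\log_+x=\max(\log x,0)$ and the ratio is $+\infty$ where only its denominator vanishes. 5. For all $N$, $\theta_1,\dots,\theta_N,\theta'\in\Xi$ and weights $w_i\ge0$ with $\sum_i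 w_i=1$: $\sum_i w_i\theta_i\in\Xi$ and $\rho\big(\sum_i w_i\theta_i,\theta'\big)\le\sum_i w_i\,\rho(\theta_i,\theta')$. For each $s$ let $\bar p=\bar p_s$ be, for $P^{(S)}_{\theta_0}$-almost every data set, a $W_2$ barycenter of the client posteriors $p(\cdot\mid D_1),\dots,p(\cdot\mid D_K)$. Then, as $s\to\infty$, $$W_2(\bar p,\delta_{\theta_0})=O_p\left(\sqrt{\frac{\log^{2/\alpha}s}{s^{1/\alpha}}}\right)\quad\text{with respect to }P^{(S)}_{\theta_0},$$ that is, for every $\varepsilon>0$ there is $C>0$ such that, for all sufficiently large $s$, the (outer) $P^{(S)}_{\theta_0}$-probability of $W_2(\bar p,\delta_{\theta_0})>C\sqrt{\log^{2/\alpha}s/s^{1/\alpha}}$ is at most $\varepsilon$. -/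

import Mathlib

open Filter MeasureTheory
open scoped NNReal ENNReal Topology

noncomputable section

/-- The points of a parameter set `Ξ ⊆ ℝ^M`. This type deliberately inherits no topology from
`ℝ^M`: its metric `ρ` is supplied as a `MetricSpace` instance. -/
structure Param {M : ℕ} (Ξ : Set (EuclideanSpace ℝ (Fin M))) where
  val : EuclideanSpace ℝ (Fin M)
  mem : val ∈ Ξ

section Hellinger

variable {Y : Type*} [MeasurableSpace Y]

/-- The Hellinger distance `(∫ (√f - √g)²)^{1/2}` between two nonnegative functions. -/
def hellinger (ν : Measure Y) (f g : Y → ℝ≥0) : ℝ≥0∞ :=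
  (∫⁻ y, ENNReal.ofReal ((√(f y : ℝ) - √(g y : ℝ)) ^ 2) ∂ν) ^ (1 / 2 : ℝ)

/-- The pseudo Hellinger distance between two `s`-tuples of nonnegative functions: the square root
of the average over `i` of the squared Hellinger distances of the `i`-th entries. -/
def pseudoHellinger (ν : Measure Y) {s : ℕ} (f g : Fin s → Y → ℝ≥0) : ℝ≥0∞ :=
  ((s : ℝ≥0∞)⁻¹ * ∑ i, hellinger ν (f i) (g i) ^ 2) ^ (1 / 2 : ℝ)

/-- The class `F` of `s`-tuples of densities can be covered by `N` brackets `[l j, U j]` (of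
`s`-tuples) whose pseudo Hellinger size is at most `u`. -/
def HasBracketCover (ν : Measure Y) {s : ℕ} (F : Set (Fin s → Y → ℝ≥0)) (u : ℝ) (N : ℕ) : Prop :=
  ∃ l U : Fin N → Fin s → Y → ℝ≥0,
    (∀ j i, Measurable (l j i) ∧ Measurable (U j i)) ∧
    (∀ j, pseudoHellinger ν (l j) (U j) ≤ ENNReal.ofReal u) ∧
    ∀ f ∈ F, ∃ j, ∀ i, l j i ≤ᵐ[ν] f i ∧ f i ≤ᵐ[ν] U j i

/-- The generalized bracketing entropy: the logarithm of the least number of brackets of size `u`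
needed to cover `F` (it is `⊤` if no finite number suffices). -/
def bracketingEntropy (ν : Measure Y) {s : ℕ} (F : Set (Fin s → Y → ℝ≥0)) (u : ℝ) : EReal :=
  ENNReal.log (⨅ (N : ℕ) (_ : HasBracketCover ν F u N), (N : ℝ≥0∞))

end Hellinger

section Wasserstein

variable {Θ : Type*} [MetricSpace Θ] [MeasurableSpace Θ]

/-- The squared 2-Wasserstein distance: the infimum of the transport cost `E[ρ(x, x')²]` over all
couplings of `μ` and `μ'`. -/
def wassersteinSq (μ μ' : Measure Θ) : ℝ≥0∞ :=
  ⨅ (π : Measure (Θ × Θ)) (_ : π.map Prod.fst = μ ∧ π.map Prod.snd = μ'),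
    ∫⁻ z, edist z.1 z.2 ^ 2 ∂π

/-- The 2-Wasserstein distance. -/
def wasserstein (μ μ' : Measure Θ) : ℝ≥0∞ :=
  wassersteinSq μ μ' ^ (1 / 2 : ℝ)

/-- `b` is a (uniformly weighted) 2-Wasserstein barycenter of `μ 1, …, μ K`. -/
def IsWassersteinBarycenter {K : ℕ} (μ : Fin K → Measure Θ) (b : Measure Θ) : Prop :=
  IsProbabilityMeasure b ∧ ∀ q : Measure Θ, IsProbabilityMeasure q →
    (K : ℝ≥0∞)⁻¹ * ∑ k, wasserstein b (μ k) ^ 2 ≤ (K : ℝ≥0∞)⁻¹ * ∑ k, wasserstein q (μ k) ^ 2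

end Wasserstein

section Posterior

variable {Θ Y : Type*} [MeasurableSpace Θ] [MeasurableSpace Y]

/-- The posterior distribution, by Bayes' rule, from the prior distribution `prior` and `s` independent observations
`D i` with densities `f i θ`. -/
def posterior (prior : Measure Θ) {s : ℕ} (f : Fin s → Θ → Y → ℝ≥0) (D : Fin s → Y) : Measure Θ :=
  (∫⁻ θ, ∏ i, (f i θ (D i) : ℝ≥0∞) ∂prior)⁻¹ • prior.withDensity fun θ => ∏ i, (f i θ (D i) : ℝ≥0∞)

/-- The law under the parameter `θ` of all the data of the `K` clients, `s` independent
observations each, the `i`-th observation of client `k` having density `f k i θ`. -/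
def dataLaw (ν : Measure Y) {K s : ℕ} (f : Fin K → Fin s → Θ → Y → ℝ≥0) (θ : Θ) :
    Measure (Fin K → Fin s → Y) :=
  Measure.pi fun k => Measure.pi fun i => ν.withDensity fun y => (f k i θ y : ℝ≥0∞)

end Posterior

/-- `X s = O_p(r s)` as `s → ∞`, where `X s` is a `[0, ∞]`-valued function on a space with
probability measure `P s`. -/
def IsBigOP {Ω : ℕ → Type*} [∀ s, MeasurableSpace (Ω s)] (P : ∀ s, Measure (Ω s))
    (X : ∀ s, Ω s → ℝ≥0∞) (r : ℕ → ℝ) : Prop :=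
  ∀ ε : ℝ, 0 < ε → ∃ C : ℝ, 0 < C ∧
    ∀ᶠ s in atTop, P s {ω | ENNReal.ofReal (C * r s) < X s ω} ≤ ENNReal.ofReal ε

section Assumptions

variable {Y : Type*} [MeasurableSpace Y] {K : ℕ}

/-- The family `p` consists of probability densities with respect to `ν`, jointly measurable in the
parameter and the observation. Here `p s k i θ` is the density under `θ` of the `i`-th
observation of client `k` when every client has `s` observations. -/
def IsDensityFamily {Θ : Type*} [MeasurableSpace Θ] (ν : Measure Y)
    (p : (s : ℕ) → Fin K → Fin s → Θ → Y → ℝ≥0) : Prop :=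
  ∀ s k i, Measurable (fun z : Θ × Y => p s k i z.1 z.2) ∧
    ∀ θ, ∫⁻ y, (p s k i θ y : ℝ≥0∞) ∂ν = 1

/-- Identifiability: `h_{sk}²(θ, θ') ≥ C_L ρ(θ, θ')^{2α}`. -/
def Identifiability {Θ : Type*} [MetricSpace Θ] (ν : Measure Y)
    (p : (s : ℕ) → Fin K → Fin s → Θ → Y → ℝ≥0) (α : ℝ) : Prop :=
  ∃ CL : ℝ, 0 < CL ∧ ∀ᶠ s in atTop, ∀ k, ∀ θ θ' : Θ,
    ENNReal.ofReal (CL * dist θ θ' ^ (2 * α)) ≤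
      pseudoHellinger ν (fun i => p s k i θ) (fun i => p s k i θ') ^ 2

/-- The bracketing entropy condition. -/
def EntropyCondition {Θ : Type*} (ν : Measure Y)
    (p : (s : ℕ) → Fin K → Fin s → Θ → Y → ℝ≥0) (θ₀ : Θ) : Prop :=
  ∃ (C₁ C₂ : ℝ) (Ψ : ℝ → ℝ → ℝ), 0 < C₁ ∧ 0 < C₂ ∧ C₂ < C₁ ^ 2 / 2 ^ 12 ∧
    (∀ u r, 0 < u → 0 < r → 0 < Ψ u r) ∧
    (∀ r, 0 < r → AntitoneOn (fun u => Ψ u r) (Set.Ioi 0)) ∧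
    (∀ u, 0 < u → MonotoneOn (fun r => Ψ u r) (Set.Ioi 0)) ∧
    ∀ᶠ s : ℕ in atTop,
      (∀ k, ∀ u r : ℝ, 0 < u → 0 < r →
        bracketingEntropy ν
          {f | ∃ θ : Θ, (f = fun i => p s k i θ) ∧
            pseudoHellinger ν (fun i => p s k i θ) (fun i => p s k i θ₀) ≤ ENNReal.ofReal r} u
          ≤ (Ψ u r : EReal)) ∧
      ∀ r : ℝ, Real.log s / √(s : ℝ) ≤ r →
        ∫ u in (C₁ * r ^ 2 / 2 ^ 12)..(C₁ * r), √(Ψ u r) < C₂ * √(s : ℝ) * r ^ 2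

/-- The prior mass condition. The ratio of densities is `⊤` where only the denominator vanishes. -/
def PriorMassCondition {Θ : Type*} [MeasurableSpace Θ] (ν : Measure Y)
    (p : (s : ℕ) → Fin K → Fin s → Θ → Y → ℝ≥0) (prior : Measure Θ) (θ₀ : Θ) : Prop :=
  ∃ κ c : ℝ, 0 < κ ∧ 0 < c ∧ ∀ᶠ s : ℕ in atTop, ∀ k,
    ENNReal.ofReal (Real.exp (-c * K * Real.log s ^ 2)) ≤
      prior {θ | (s : ℝ≥0∞)⁻¹ * (∑ i : Fin s,
          ∫⁻ y, EReal.exp ((κ : EReal) *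
              max (ENNReal.log ((p s k i θ₀ y : ℝ≥0∞) / (p s k i θ y : ℝ≥0∞))) 0)
            ∂(ν.withDensity fun y => (p s k i θ₀ y : ℝ≥0∞))) - 1
        ≤ ENNReal.ofReal (Real.log s ^ 2 / s)}

/-- Convexity of the metric: convex combinations stay in the parameter set, and the distance of a
convex combination to a point is at most the convex combination of the distances. -/
def ConvexMetric {M : ℕ} (Ξ : Set (EuclideanSpace ℝ (Fin M))) [MetricSpace (Param Ξ)] : Prop :=
  ∀ (N : ℕ) (w : Fin N → ℝ) (θ : Fin N → Param Ξ) (θ' : Param Ξ),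
    (∀ i, 0 ≤ w i) → ∑ i, w i = 1 →
      ∃ b : Param Ξ, b.val = ∑ i, w i • (θ i).val ∧ dist b θ' ≤ ∑ i, w i * dist (θ i) θ'

end Assumptions

end

/-! Each client posterior contracts around `θ₀` in second moment, and a barycenter inherits this.
The Dirac mass at `θ₀` is a competitor in the barycenter problem, so optimality and the triangle
inequality bound the second moment of the barycenter about `θ₀` by four times a common bound for the
clients (`IsWassersteinBarycenter.lintegral_edist_sq_le`).

For one client, `IsExperiment.sampleLaw_posterior_le` compares two evidences at the Hellinger radius
given by `s h² = M² log² s`. The evidence outside this ball is split into shells, each covered by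
few small Hellinger balls. A product of Birgé's bounded ratios separates `θ₀` from a whole small
ball at once (`prod_lintegral_robustRatio_le`), so a covering number is all that is needed of the
model (`sampleLaw_shell_le`). The total evidence is bounded below by Markov's inequality for the
exponential moments in the prior mass condition (`sampleLaw_evidence_lt_le`).

Brackets supply the balls. Their number is controlled because `Ψ` does not depend on `s`: the
entropy integral at a sample size near `s / M²` bounds the entropy by a constant times `s r² / M²`,
which is as small a multiple of `s r²` as desired (`eventually_entropy_le`). Finally,
identifiability turns Hellinger radii into `ρ`-radii, and compactness bounds the cost of the
exponentially small remaining mass. -/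

/-! ### Birgé's robust ratio for a single observation. -/

section RobustTest

variable {Y : Type*} [MeasurableSpace Y]

/-- The squared Hellinger distance, as a lower Lebesgue integral. -/
noncomputable def hellingerSq (ν : Measure Y) (f g : Y → ℝ≥0) : ℝ≥0∞ :=
  ∫⁻ y, ENNReal.ofReal ((√(f y : ℝ) - √(g y : ℝ)) ^ 2) ∂ν

/-- The sum over the entries of the squared Hellinger distances between two tuples. -/
noncomputable def sumHellingerSq (ν : Measure Y) {s : ℕ} (f g : Fin s → Y → ℝ≥0) : ℝ≥0∞ :=
  ∑ i, hellingerSq ν (f i) (g i)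

/-- Birgé's bounded ratio, which compares `q` to `p` and is robust to perturbations of `q`
in Hellinger distance. -/
noncomputable def robustRatio (p q : ℝ≥0) : ℝ≥0∞ :=
  ENNReal.ofReal ((√(q : ℝ) + √(p : ℝ) / 2) / (√(p : ℝ) + √(q : ℝ) / 2))

lemma measurable_robustRatio {p q : Y → ℝ≥0} (hp : Measurable p) (hq : Measurable q) :
    Measurable fun y => robustRatio (p y) (q y) := by
  unfold robustRatio
  fun_prop

/-- Links the two error bounds of a test: where one product of ratios is at most one, the reversed
product is at least one. At `p = q = 0` it would fail, as `0 / 0 = 0`. -/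
lemma robustRatio_mul_swap {p : ℝ≥0} (hp : p ≠ 0) (q : ℝ≥0) :
    robustRatio p q * robustRatio q p = 1 := by
  have hp' : 0 < √(p : ℝ) := Real.sqrt_pos.2 (by exact_mod_cast pos_iff_ne_zero.2 hp)
  have hq' : 0 ≤ √(q : ℝ) := Real.sqrt_nonneg _
  unfold robustRatio
  rw [← ENNReal.ofReal_mul (by positivity), ← ENNReal.ofReal_one]
  congr 1
  field_simp

/-- Here `x`, `y`, `z` stand for `√p`, `√q`, `√f`. Expand `z² g` around `z = y`. The leading term
gains through `12 y² (g - 1) ≤ 4 y (x - y) = 2 x² - 2 y² - 2 (x - y)²`; the cross term gives back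
one `(x - y)²`, and everything else is of order `(z - y)²` because `g ≤ 2`. -/
lemma real_robust_bound {x y z : ℝ} (hx : 0 ≤ x) (hy : 0 ≤ y) :
    12 * (z ^ 2 * ((x + y / 2) / (y + x / 2))) + 2 * y ^ 2 + (x - y) ^ 2
      ≤ 12 * z ^ 2 + 2 * x ^ 2 + 48 * (z - y) ^ 2 := by
  rcases eq_or_lt_of_le (show 0 ≤ y + x / 2 by positivity) with h0 | h0
  · have hx0 : x = 0 := by linarith
    have hy0 : y = 0 := by linarith
    subst hx0; subst hy0
    simp
    positivity
  · set g := (x + y / 2) / (y + x / 2) with hg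
    have hg2 : g ≤ 2 := by
      rw [hg, div_le_iff₀ h0]; linarith
    have hg0 : 0 ≤ g := by positivity
    have hmul : g * (y + x / 2) = x + y / 2 := div_mul_cancel₀ _ h0.ne'
    have h1 : y ^ 2 * (g - 1) ≤ y * (x - y) / 3 := by
      have e : (g - 1) * (y + x / 2) = (x - y) / 2 := by linarith
      have : y ^ 2 * (g - 1) * (y + x / 2) ≤ y * (x - y) / 3 * (y + x / 2) := by
        rw [mul_assoc, e]
        nlinarith [mul_nonneg hy (sq_nonneg (x - y))]
      exact le_of_mul_le_mul_right this h0
    have habs : |y * (g - 1)| ≤ |x - y| / 2 := by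
      have e : (g - 1) * (y + x / 2) = (x - y) / 2 := by linarith
      have : |y * (g - 1)| * (y + x / 2) ≤ |x - y| / 2 * (y + x / 2) := by
        have : |y * (g - 1)| * (y + x / 2) = y * (|x - y| / 2) := by
          rw [abs_mul, abs_of_nonneg hy, mul_assoc]
          congr 1
          calc |g - 1| * (y + x / 2) = |g - 1| * |y + x / 2| := by rw [abs_of_pos h0]
            _ = |x - y| / 2 := by rw [← abs_mul, e, abs_div]; norm_num
        rw [this]
        nlinarith [mul_nonneg hx (abs_nonneg (x - y))]
      exact le_of_mul_le_mul_right this h0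
    have h2 : 2 * (z - y) * (y * (g - 1)) ≤ 3 * (z - y) ^ 2 + (x - y) ^ 2 / 12 := by
      have : 2 * (z - y) * (y * (g - 1)) ≤ 2 * |z - y| * (|x - y| / 2) := by
        calc 2 * (z - y) * (y * (g - 1)) ≤ |2 * (z - y) * (y * (g - 1))| := le_abs_self _
          _ = 2 * |z - y| * |y * (g - 1)| := by rw [abs_mul, abs_mul]; norm_num
          _ ≤ _ := by gcongr
      have e1 := sq_abs (z - y)
      have e2 := sq_abs (x - y)
      nlinarith [sq_nonneg (6 * |z - y| - |x - y|)]
    have h3 : (z - y) ^ 2 * g ≤ (z - y) ^ 2 * 2 := by gcongr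
    have e : z ^ 2 * g = y ^ 2 * (g - 1) + y ^ 2 + 2 * (z - y) * (y * (g - 1))
      + 2 * y * (z - y) + (z - y) ^ 2 * g := by ring
    rw [e]
    nlinarith

lemma robustRatio_bound (f p q : ℝ≥0) :
    12 * (f * robustRatio q p) + 2 * q + ENNReal.ofReal ((√(p : ℝ) - √(q : ℝ)) ^ 2)
      ≤ 12 * f + 2 * p + 48 * ENNReal.ofReal ((√(f : ℝ) - √(q : ℝ)) ^ 2) := by
  have key := real_robust_bound (x := √(p : ℝ)) (y := √(q : ℝ)) (z := √(f : ℝ))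
    (Real.sqrt_nonneg _) (Real.sqrt_nonneg _)
  simp only [Real.sq_sqrt (NNReal.coe_nonneg _)] at key
  have c : ∀ a : ℝ≥0, (a : ℝ≥0∞) = ENNReal.ofReal (a : ℝ) := fun a => by simp
  have n : ∀ m : ℕ, [m.AtLeastTwo] → (OfNat.ofNat m : ℝ≥0∞) = ENNReal.ofReal (OfNat.ofNat m) :=
    fun m _ => (ENNReal.ofReal_ofNat m).symm
  unfold robustRatio
  rw [c f, c p, c q, n 12, n 2, n 48]
  rw [← ENNReal.ofReal_mul (by positivity), ← ENNReal.ofReal_mul (by positivity),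
    ← ENNReal.ofReal_mul (by positivity), ← ENNReal.ofReal_mul (by positivity),
    ← ENNReal.ofReal_mul (by positivity), ← ENNReal.ofReal_mul (by positivity),
    ← ENNReal.ofReal_add (by positivity) (by positivity),
    ← ENNReal.ofReal_add (by positivity) (by positivity),
    ← ENNReal.ofReal_add (by positivity) (by positivity),
    ← ENNReal.ofReal_add (by positivity) (by positivity)]
  exact ENNReal.ofReal_le_ofReal key

/-- On integrating the pointwise bound, the masses of `p` and `q` cancel: the mean of the ratio
under `f` is at most `1 - h²(p,q)/12 + 4 h²(f,q)`, written without subtraction. -/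
lemma lintegral_mul_robustRatio_le {ν : Measure Y} {f p q : Y → ℝ≥0} (hf : Measurable f)
    (hp : Measurable p) (hq : Measurable q) (hf1 : ∫⁻ y, (f y : ℝ≥0∞) ∂ν = 1)
    (hp1 : ∫⁻ y, (p y : ℝ≥0∞) ∂ν = 1) (hq1 : ∫⁻ y, (q y : ℝ≥0∞) ∂ν = 1) :
    12 * ∫⁻ y, f y * robustRatio (q y) (p y) ∂ν + hellingerSq ν p q
      ≤ 12 + 48 * hellingerSq ν f q := by
  have hr := measurable_robustRatio hq hp
  have h := lintegral_mono (μ := ν) fun y => robustRatio_bound (f y) (p y) (q y)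
  rw [lintegral_add_left (by fun_prop), lintegral_add_left (by fun_prop),
    lintegral_add_left (by fun_prop), lintegral_add_left (by fun_prop),
    lintegral_const_mul _ (by fun_prop), lintegral_const_mul _ (by fun_prop),
    lintegral_const_mul _ (by fun_prop), lintegral_const_mul _ (by fun_prop),
    lintegral_const_mul _ (by fun_prop), hf1, hp1, hq1] at h
  have h' : 12 * ∫⁻ y, f y * robustRatio (q y) (p y) ∂ν + hellingerSq ν p q + 2
      ≤ 12 + 48 * hellingerSq ν f q + 2 := by
    unfold hellingerSq
    simp only [mul_one] at h
    rw [add_right_comm, add_right_comm (12 : ℝ≥0∞)]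
    exact h
  exact (ENNReal.add_le_add_iff_right (by norm_num)).1 h'

end RobustTest

/-! ### Products over independent observations. -/

/-- The bound `∏ aᵢ ≤ exp (∑ (aᵢ - 1))`. -/
lemma ENNReal.prod_le_ofReal_exp {s : ℕ} (a : Fin s → ℝ≥0∞) {t u : ℝ} (ht : 0 ≤ t) (hu : 0 ≤ u)
    (h : ∑ i, a i + ENNReal.ofReal t ≤ s + ENNReal.ofReal u) :
    ∏ i, a i ≤ ENNReal.ofReal (Real.exp (u - t)) := by
  have hfin : ∑ i, a i ≠ ⊤ := by
    intro h'
    rw [h', top_add, top_le_iff] at h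
    simp at h
  have hai : ∀ i, a i ≠ ⊤ := fun i => (ENNReal.sum_ne_top.1 hfin) i (Finset.mem_univ i)
  have e : ∏ i, a i = ENNReal.ofReal (∏ i, (a i).toReal) := by
    rw [ENNReal.ofReal_prod_of_nonneg fun i _ => ENNReal.toReal_nonneg]
    exact Finset.prod_congr rfl fun i _ => (ENNReal.ofReal_toReal (hai i)).symm
  have hs : ∑ i, (a i).toReal + t ≤ s + u := by
    rw [← ENNReal.toReal_sum fun i _ => hai i]
    have := ENNReal.toReal_mono (by simp) h
    rwa [ENNReal.toReal_add hfin ENNReal.ofReal_ne_top,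
      ENNReal.toReal_add (by simp) ENNReal.ofReal_ne_top, ENNReal.toReal_ofReal ht,
      ENNReal.toReal_ofReal hu, ENNReal.toReal_natCast] at this
  rw [e]
  refine ENNReal.ofReal_le_ofReal ?_
  calc ∏ i, (a i).toReal ≤ ∏ i, Real.exp ((a i).toReal - 1) :=
        Finset.prod_le_prod (fun i _ => ENNReal.toReal_nonneg)
          fun i _ => by linarith [Real.add_one_le_exp ((a i).toReal - 1)]
    _ = Real.exp (∑ i, ((a i).toReal - 1)) := (Real.exp_sum _ _).symm
    _ ≤ _ := by
      rw [Real.exp_le_exp, Finset.sum_sub_distrib]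
      simp
      linarith

lemma MeasureTheory.lintegral_pi_prod {s : ℕ} {Y : Type*} [MeasurableSpace Y]
    (μ : Fin s → Measure Y) [∀ i, IsProbabilityMeasure (μ i)] {φ : Fin s → Y → ℝ≥0∞}
    (hφ : ∀ i, Measurable (φ i)) :
    ∫⁻ D, ∏ i, φ i (D i) ∂(Measure.pi μ) = ∏ i, ∫⁻ y, φ i y ∂(μ i) := by
  rw [ProbabilityTheory.lintegral_prod_eq_prod_lintegral_of_indepFun Finset.univ
    (fun i (D : Fin s → Y) => φ i (D i))
    (ProbabilityTheory.iIndepFun_pi fun i => (hφ i).aemeasurable)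
    fun i => (hφ i).comp (measurable_pi_apply i)]
  refine Finset.prod_congr rfl fun i _ => ?_
  rw [← (measurePreserving_eval μ i).map_eq, lintegral_map (hφ i) (measurable_pi_apply i)]

/-! ### Likelihood ratios and tests for one client. -/

section Experiment

variable {Θ Y : Type*} [MeasurableSpace Θ] [MeasurableSpace Y]

/-- The entries of `p` are families of probability densities, jointly measurable in the parameter
and the observation. -/
structure IsExperiment (ν : Measure Y) {s : ℕ} (p : Fin s → Θ → Y → ℝ≥0) : Prop where
  measurable : ∀ i, Measurable fun z : Θ × Y => p i z.1 z.2
  lintegral_eq_one : ∀ i θ, ∫⁻ y, (p i θ y : ℝ≥0∞) ∂ν = 1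

/-- The law of `s` independent observations with densities `p i θ`. -/
noncomputable def sampleLaw (ν : Measure Y) {s : ℕ} (p : Fin s → Θ → Y → ℝ≥0) (θ : Θ) : Measure (Fin s → Y) :=
  Measure.pi fun i => ν.withDensity fun y => (p i θ y : ℝ≥0∞)

/-- The likelihood ratio of `θ` against `θ₀`. -/
noncomputable def likelihoodRatio {s : ℕ} (p : Fin s → Θ → Y → ℝ≥0) (θ₀ θ : Θ) (D : Fin s → Y) : ℝ≥0∞ :=
  ∏ i, (p i θ (D i) : ℝ≥0∞) / (p i θ₀ (D i) : ℝ≥0∞)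

variable {ν : Measure Y} {s : ℕ} {p : Fin s → Θ → Y → ℝ≥0}

namespace IsExperiment

lemma measurable_density (hp : IsExperiment ν p) (i : Fin s) (θ : Θ) : Measurable (p i θ) :=
  (hp.measurable i).comp measurable_prodMk_left

lemma isProbabilityMeasure_withDensity (hp : IsExperiment ν p) (θ : Θ) (i : Fin s) :
    IsProbabilityMeasure (ν.withDensity fun y => (p i θ y : ℝ≥0∞)) :=
  ⟨by rw [withDensity_apply _ .univ, setLIntegral_univ, hp.lintegral_eq_one]⟩

lemma isProbabilityMeasure_sampleLaw (hp : IsExperiment ν p) (θ : Θ) :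
    IsProbabilityMeasure (sampleLaw ν p θ) := by
  have := hp.isProbabilityMeasure_withDensity θ
  unfold sampleLaw
  infer_instance

lemma ae_density_ne_zero (hp : IsExperiment ν p) (θ : Θ) :
    ∀ᵐ D ∂(sampleLaw ν p θ), ∀ i, p i θ (D i) ≠ 0 := by
  have := hp.isProbabilityMeasure_withDensity θ
  refine ae_all_iff.2 fun i => ?_
  have h : ∀ᵐ y ∂(ν.withDensity fun y => (p i θ y : ℝ≥0∞)), p i θ y ≠ 0 := by
    rw [ae_withDensity_iff (hp.measurable_density i θ).coe_nnreal_ennreal]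
    exact Eventually.of_forall fun y hy => by exact_mod_cast hy
  exact (Measure.quasiMeasurePreserving_eval
    (fun i => ν.withDensity fun y => (p i θ y : ℝ≥0∞)) i).ae h

lemma measurable_likelihoodRatio (hp : IsExperiment ν p) (θ₀ : Θ) :
    Measurable fun z : Θ × (Fin s → Y) => likelihoodRatio p θ₀ z.1 z.2 := by
  unfold likelihoodRatio
  refine Finset.measurable_prod _ fun i _ => ?_
  refine Measurable.div ?_ ?_
  · exact ((hp.measurable i).comp
      (measurable_fst.prodMk ((measurable_pi_apply i).comp measurable_snd))).coe_nnreal_ennreal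
  · exact ((hp.measurable_density i θ₀).comp
      ((measurable_pi_apply i).comp measurable_snd)).coe_nnreal_ennreal

lemma measurable_sumHellingerSq [SFinite ν] (hp : IsExperiment ν p) {q : Fin s → Y → ℝ≥0}
    (hq : ∀ i, Measurable (q i)) : Measurable fun θ => sumHellingerSq ν (fun i => p i θ) q := by
  unfold sumHellingerSq hellingerSq
  refine Finset.measurable_sum _ fun i _ => ?_
  have h1 := hp.measurable i
  have h2 := hq i
  refine Measurable.lintegral_prod_right' (f := fun z : Θ × Y =>
    ENNReal.ofReal ((√(p i z.1 z.2 : ℝ) - √(q i z.2 : ℝ)) ^ 2)) ?_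
  have h3 : Measurable fun z : Θ × Y => q i z.2 := h2.comp measurable_snd
  fun_prop

lemma lintegral_prod_sampleLaw (hp : IsExperiment ν p) (θ₀ : Θ) {φ : Fin s → Y → ℝ≥0∞}
    (hφ : ∀ i, Measurable (φ i)) :
    ∫⁻ D, ∏ i, φ i (D i) ∂(sampleLaw ν p θ₀) = ∏ i, ∫⁻ y, p i θ₀ y * φ i y ∂ν := by
  have := hp.isProbabilityMeasure_withDensity θ₀
  unfold sampleLaw
  rw [lintegral_pi_prod _ hφ]
  refine Finset.prod_congr rfl fun i _ => ?_
  rw [lintegral_withDensity_eq_lintegral_mul _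
    (hp.measurable_density i θ₀).coe_nnreal_ennreal (hφ i)]
  rfl

/-- Change of measure from `θ₀` to `θ`. Equality can fail because the mass of `θ` where the density
of `θ₀` vanishes is lost. -/
lemma lintegral_likelihoodRatio_mul_le (hp : IsExperiment ν p) (θ₀ θ : Θ) {φ : Fin s → Y → ℝ≥0∞}
    (hφ : ∀ i, Measurable (φ i)) :
    ∫⁻ D, likelihoodRatio p θ₀ θ D * ∏ i, φ i (D i) ∂(sampleLaw ν p θ₀)
      ≤ ∏ i, ∫⁻ y, p i θ y * φ i y ∂ν := by
  simp only [likelihoodRatio, ← Finset.prod_mul_distrib]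
  have hm : ∀ i, Measurable fun y => (p i θ y : ℝ≥0∞) / p i θ₀ y * φ i y := fun i =>
    ((hp.measurable_density i θ).coe_nnreal_ennreal.div
      (hp.measurable_density i θ₀).coe_nnreal_ennreal).mul (hφ i)
  rw [hp.lintegral_prod_sampleLaw θ₀ hm]
  refine Finset.prod_le_prod' fun i _ => lintegral_mono fun y => ?_
  rw [← mul_assoc]
  gcongr
  exact ENNReal.mul_div_le

lemma lintegral_likelihoodRatio_le_one (hp : IsExperiment ν p) (θ₀ θ : Θ) :
    ∫⁻ D, likelihoodRatio p θ₀ θ D ∂(sampleLaw ν p θ₀) ≤ 1 := by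
  have := hp.lintegral_likelihoodRatio_mul_le θ₀ θ (φ := fun _ _ => 1) fun _ => measurable_const
  simpa [hp.lintegral_eq_one] using this

lemma ae_lintegral_likelihoodRatio_lt_top (hp : IsExperiment ν p) (θ₀ : Θ)
    (prior : Measure Θ) [IsProbabilityMeasure prior] :
    ∀ᵐ D ∂(sampleLaw ν p θ₀), ∫⁻ θ, likelihoodRatio p θ₀ θ D ∂prior < ⊤ := by
  have := hp.isProbabilityMeasure_sampleLaw θ₀
  have hm := hp.measurable_likelihoodRatio θ₀
  refine ae_lt_top hm.lintegral_prod_left' (ne_top_of_le_ne_top ENNReal.one_ne_top ?_)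
  rw [lintegral_lintegral_swap (f := fun D θ => likelihoodRatio p θ₀ θ D)
    (hm.comp measurable_swap).aemeasurable]
  calc _ ≤ ∫⁻ _, 1 ∂prior := lintegral_mono fun θ => hp.lintegral_likelihoodRatio_le_one θ₀ θ
    _ = 1 := by simp

/-- The expectation of the robust test statistic is exponentially small under every density tuple
that is much closer to the alternative than the null hypothesis is. -/
lemma prod_lintegral_robustRatio_le {f p q : Fin s → Y → ℝ≥0}
    (hf : ∀ i, Measurable (f i)) (hp : ∀ i, Measurable (p i)) (hq : ∀ i, Measurable (q i))
    (hf1 : ∀ i, ∫⁻ y, (f i y : ℝ≥0∞) ∂ν = 1) (hp1 : ∀ i, ∫⁻ y, (p i y : ℝ≥0∞) ∂ν = 1)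
    (hq1 : ∀ i, ∫⁻ y, (q i y : ℝ≥0∞) ∂ν = 1) {T : ℝ} (hT : 0 ≤ T)
    (hpq : ENNReal.ofReal T ≤ sumHellingerSq ν p q)
    (hfq : sumHellingerSq ν f q ≤ ENNReal.ofReal (T / 100)) :
    ∏ i, ∫⁻ y, f i y * robustRatio (q i y) (p i y) ∂ν ≤ ENNReal.ofReal (Real.exp (-T / 24)) := by
  have h : ∑ i, ∫⁻ y, f i y * robustRatio (q i y) (p i y) ∂ν + ENNReal.ofReal (T / 12)
      ≤ s + ENNReal.ofReal (T / 25) := by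
    have h1 := Finset.sum_le_sum fun i (_ : i ∈ Finset.univ) =>
      lintegral_mul_robustRatio_le (hf i) (hp i) (hq i) (hf1 i) (hp1 i) (hq1 i)
    rw [Finset.sum_add_distrib, Finset.sum_add_distrib, ← Finset.mul_sum, ← Finset.mul_sum] at h1
    have e1 : ENNReal.ofReal T = 12 * ENNReal.ofReal (T / 12) := by
      rw [← ENNReal.ofReal_ofNat 12, ← ENNReal.ofReal_mul (by norm_num)]; congr 1; ring
    have e2 : 48 * ENNReal.ofReal (T / 100) = 12 * ENNReal.ofReal (T / 25) := by
      rw [← ENNReal.ofReal_ofNat 12, ← ENNReal.ofReal_ofNat 48,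
        ← ENNReal.ofReal_mul (by norm_num), ← ENNReal.ofReal_mul (by norm_num)]
      congr 1; ring
    have h2 : 12 * (∑ i, ∫⁻ y, f i y * robustRatio (q i y) (p i y) ∂ν + ENNReal.ofReal (T / 12))
        ≤ 12 * (s + ENNReal.ofReal (T / 25)) := by
      rw [mul_add, mul_add, ← e1, ← e2]
      refine le_trans ?_ (h1.trans ?_)
      · gcongr; exact hpq
      · gcongr
        · simp [mul_comm]
        · exact hfq
    exact (ENNReal.mul_le_mul_iff_right (by norm_num) (by norm_num)).1 h2
  -- The exponent is `T/25 - T/12 = -13T/300`, just below `-T/24`.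
  refine (ENNReal.prod_le_ofReal_exp _ (by positivity) (by positivity) h).trans ?_
  refine ENNReal.ofReal_le_ofReal (Real.exp_le_exp.2 ?_)
  linarith

/-- The evidence carried by a Hellinger shell around the true parameter is exponentially small,
provided that the shell is covered by few small Hellinger balls. -/
lemma sampleLaw_shell_le [SFinite ν] (hp : IsExperiment ν p) (θ₀ : Θ) (prior : Measure Θ)
    [IsProbabilityMeasure prior] {T : ℝ} (hT : 0 ≤ T) {A : Set Θ} {N : ℕ}
    (hN : (N : ℝ) ≤ Real.exp (T / 48)) (c : Fin N → Θ)
    (hc : ∀ j, ENNReal.ofReal T ≤ sumHellingerSq ν (fun i => p i θ₀) (fun i => p i (c j)))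
    (hA : ∀ θ ∈ A, ∃ j, sumHellingerSq ν (fun i => p i θ) (fun i => p i (c j))
      ≤ ENNReal.ofReal (T / 100)) :
    sampleLaw ν p θ₀ {D | ENNReal.ofReal (Real.exp (-T / 96))
        < ∫⁻ θ in A, likelihoodRatio p θ₀ θ D ∂prior}
      ≤ ENNReal.ofReal (2 * Real.exp (-T / 96)) := by
  have := hp.isProbabilityMeasure_sampleLaw θ₀
  set P := sampleLaw ν p θ₀ with hP
  have hd := hp.measurable_density
  have hm := hp.measurable_likelihoodRatio θ₀
  let ball : Fin N → Set Θ := fun j => {θ | sumHellingerSq ν (fun i => p i θ) (fun i => p i (c j))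
      ≤ ENNReal.ofReal (T / 100)}
  -- `G j` is large when the data favour the centre `c j` over `θ₀`; `G' j` is its reciprocal almost
  -- surely.
  let G : Fin N → (Fin s → Y) → ℝ≥0∞ := fun j D => ∏ i, robustRatio (p i θ₀ (D i)) (p i (c j) (D i))
  let G' : Fin N → (Fin s → Y) → ℝ≥0∞ := fun j D => ∏ i, robustRatio (p i (c j) (D i)) (p i θ₀ (D i))
  have hGm : ∀ j, Measurable (G j) := fun j => Finset.measurable_prod _ fun i _ =>
    (measurable_robustRatio (hd i θ₀) (hd i (c j))).comp (measurable_pi_apply i)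
  have hG'm : ∀ j, Measurable (G' j) := fun j => Finset.measurable_prod _ fun i _ =>
    (measurable_robustRatio (hd i (c j)) (hd i θ₀)).comp (measurable_pi_apply i)
  have hself : ∀ θ, sumHellingerSq ν (fun i => p i θ) (fun i => p i θ) = 0 := by
    intro θ; simp [sumHellingerSq, hellingerSq]
  have hsymm : ∀ f g : Fin s → Y → ℝ≥0, sumHellingerSq ν f g = sumHellingerSq ν g f := by
    intro f g
    unfold sumHellingerSq hellingerSq
    refine Finset.sum_congr rfl fun i _ => lintegral_congr fun y => ?_
    congr 1; ring
  have hG : ∀ j, ∫⁻ D, G j D ∂P ≤ ENNReal.ofReal (Real.exp (-T / 24)) := by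
    intro j
    rw [hP, hp.lintegral_prod_sampleLaw θ₀ (φ := fun i y => robustRatio (p i θ₀ y) (p i (c j) y))
      fun i => measurable_robustRatio (hd i θ₀) (hd i (c j))]
    -- The roles are reversed here: `θ₀` is both the sampling density and the reference, so the
    -- perturbation is zero.
    exact prod_lintegral_robustRatio_le (fun i => hd i _) (fun i => hd i _) (fun i => hd i _)
      (fun i => hp.lintegral_eq_one i _) (fun i => hp.lintegral_eq_one i _)
      (fun i => hp.lintegral_eq_one i _) hT ((hc j).trans_eq (hsymm _ _)) (by rw [hself]; simp)
  -- When `∑ G j < 1`, every `G' j ≥ 1`, so `X j` dominates the evidence of its ball; yet its mean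
  -- is small, since the likelihood ratio moves the sampling law to a point of that ball.
  let X : Fin N → (Fin s → Y) → ℝ≥0∞ := fun j D =>
    (∫⁻ θ in ball j, likelihoodRatio p θ₀ θ D ∂prior) * G' j D
  have hXm : ∀ j, Measurable (X j) := fun j =>
    (Measurable.lintegral_prod_left' (μ := prior.restrict (ball j)) hm).mul (hG'm j)
  have hX : ∀ j, ∫⁻ D, X j D ∂P ≤ ENNReal.ofReal (Real.exp (-T / 24)) := by
    intro j
    have hpull : ∀ D, X j D = ∫⁻ θ in ball j, likelihoodRatio p θ₀ θ D * G' j D ∂prior := by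
      intro D
      exact (lintegral_mul_const _ (hm.comp measurable_prodMk_right :
        Measurable fun θ => likelihoodRatio p θ₀ θ D)).symm
    simp_rw [hpull]
    have hjm : Measurable fun z : (Fin s → Y) × Θ => likelihoodRatio p θ₀ z.2 z.1 * G' j z.1 :=
      (hm.comp measurable_swap).mul ((hG'm j).comp measurable_fst)
    rw [lintegral_lintegral_swap hjm.aemeasurable]
    calc _ ≤ ∫⁻ _ in ball j, ENNReal.ofReal (Real.exp (-T / 24)) ∂prior := by
          refine setLIntegral_mono measurable_const fun θ hθ => ?_
          refine (hp.lintegral_likelihoodRatio_mul_le θ₀ θ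
            (φ := fun i y => robustRatio (p i (c j) y) (p i θ₀ y))
            fun i => measurable_robustRatio (hd i (c j)) (hd i θ₀)).trans ?_
          exact prod_lintegral_robustRatio_le (fun i => hd i _) (fun i => hd i _)
            (fun i => hd i _) (fun i => hp.lintegral_eq_one i _)
            (fun i => hp.lintegral_eq_one i _) (fun i => hp.lintegral_eq_one i _) hT (hc j) hθ
      _ ≤ _ := by
          rw [setLIntegral_const]
          exact mul_le_of_le_one_right' prob_le_one
  have hcover : P {D | ENNReal.ofReal (Real.exp (-T / 96))
        < ∫⁻ θ in A, likelihoodRatio p θ₀ θ D ∂prior} ≤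
      P ({D | 1 ≤ ∑ j, G j D} ∪ {D | ENNReal.ofReal (Real.exp (-T / 96)) ≤ ∑ j, X j D}) := by
    refine measure_mono_ae ?_
    filter_upwards [hp.ae_density_ne_zero θ₀] with D hD hlt
    by_contra hcon
    have hcon' : ∑ j, G j D < 1 ∧ ∑ j, X j D < ENNReal.ofReal (Real.exp (-T / 96)) := by
      constructor <;> by_contra hh
      · exact hcon (Or.inl (not_lt.1 hh))
      · exact hcon (Or.inr (not_lt.1 hh))
    obtain ⟨h1, h2⟩ := hcon'
    have hle : ∫⁻ θ in A, likelihoodRatio p θ₀ θ D ∂prior ≤ ∑ j, X j D := by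
      calc _ ≤ ∫⁻ θ in ⋃ j, ball j, likelihoodRatio p θ₀ θ D ∂prior :=
            lintegral_mono_set fun θ hθ => Set.mem_iUnion.2 (hA θ hθ)
        _ ≤ ∑' j, ∫⁻ θ in ball j, likelihoodRatio p θ₀ θ D ∂prior := lintegral_iUnion_le _ _
        _ = ∑ j, ∫⁻ θ in ball j, likelihoodRatio p θ₀ θ D ∂prior := tsum_fintype _
        _ ≤ _ := by
            refine Finset.sum_le_sum fun j _ => le_mul_of_one_le_right' ?_
            have hGj : G j D ≤ 1 :=
              (Finset.single_le_sum (fun _ _ => zero_le) (Finset.mem_univ j)).trans h1.le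
            calc (1 : ℝ≥0∞) = G j D * G' j D := by
                  rw [← Finset.prod_mul_distrib]
                  exact (Finset.prod_eq_one fun i _ => robustRatio_mul_swap (hD i) _).symm
              _ ≤ 1 * G' j D := by gcongr
              _ = _ := one_mul _
    exact absurd (hlt.trans_le hle) (not_lt.2 h2.le)
  refine hcover.trans ((measure_union_le _ _).trans ?_)
  -- The number of balls costs half the exponent `T/24`; Markov's inequality for the `X j` at level
  -- `exp (-T/96)` halves it again.
  have hNE : (N : ℝ≥0∞) * ENNReal.ofReal (Real.exp (-T / 24))
      ≤ ENNReal.ofReal (Real.exp (-T / 48)) := by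
    rw [← ENNReal.ofReal_natCast, ← ENNReal.ofReal_mul (by positivity)]
    refine ENNReal.ofReal_le_ofReal ?_
    calc (N : ℝ) * Real.exp (-T / 24) ≤ Real.exp (T / 48) * Real.exp (-T / 24) := by gcongr
      _ = _ := by rw [← Real.exp_add]; congr 1; ring
  have hsum : ∀ F : Fin N → (Fin s → Y) → ℝ≥0∞, (∀ j, Measurable (F j)) →
      (∀ j, ∫⁻ D, F j D ∂P ≤ ENNReal.ofReal (Real.exp (-T / 24))) →
      ∫⁻ D, ∑ j, F j D ∂P ≤ ENNReal.ofReal (Real.exp (-T / 48)) := by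
    intro F hF hF'
    rw [lintegral_finsetSum _ fun j _ => hF j]
    refine le_trans ?_ hNE
    simpa using Finset.sum_le_sum fun j (_ : j ∈ Finset.univ) => hF' j
  have hA1 : P {D | 1 ≤ ∑ j, G j D} ≤ ENNReal.ofReal (Real.exp (-T / 96)) := by
    have := meas_ge_le_lintegral_div (μ := P) (f := fun D => ∑ j, G j D)
      (Finset.measurable_sum _ fun j _ => hGm j).aemeasurable one_ne_zero ENNReal.one_ne_top
    rw [div_one] at this
    refine this.trans ((hsum G hGm hG).trans (ENNReal.ofReal_le_ofReal (Real.exp_le_exp.2 ?_)))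
    linarith
  have hA2 : P {D | ENNReal.ofReal (Real.exp (-T / 96)) ≤ ∑ j, X j D}
      ≤ ENNReal.ofReal (Real.exp (-T / 96)) := by
    have hpos : ENNReal.ofReal (Real.exp (-T / 96)) ≠ 0 :=
      (ENNReal.ofReal_pos.2 (Real.exp_pos _)).ne'
    refine (meas_ge_le_lintegral_div (μ := P) (f := fun D => ∑ j, X j D)
      (Finset.measurable_sum _ fun j _ => hXm j).aemeasurable hpos
      ENNReal.ofReal_ne_top).trans ?_
    refine ENNReal.div_le_of_le_mul ((hsum X hXm hX).trans ?_)
    rw [← ENNReal.ofReal_mul (Real.exp_pos _).le, ← Real.exp_add]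
    refine ENNReal.ofReal_le_ofReal (Real.exp_le_exp.2 ?_)
    linarith
  calc _ ≤ ENNReal.ofReal (Real.exp (-T / 96)) + ENNReal.ofReal (Real.exp (-T / 96)) :=
        add_le_add hA1 hA2
    _ = _ := by rw [← ENNReal.ofReal_add (by positivity) (by positivity), two_mul]

end IsExperiment

end Experiment

/-! ### Numerator and denominator of the posterior. -/

section PosteriorBounds

variable {Θ Y : Type*} [MeasurableSpace Θ] [MeasurableSpace Y]

/-- The Hellinger shell `T < s h² ≤ 4 T` around `θ₀` is covered by few small Hellinger balls. -/
def HasShellCover (ν : Measure Y) {s : ℕ} (p : Fin s → Θ → Y → ℝ≥0) (θ₀ : Θ) (T : ℝ) : Prop :=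
  ∃ (N : ℕ) (c : Fin N → Θ), (N : ℝ) ≤ Real.exp (T / 48) ∧
    (∀ j, ENNReal.ofReal T ≤ sumHellingerSq ν (fun i => p i θ₀) (fun i => p i (c j))) ∧
    ∀ θ, ENNReal.ofReal T < sumHellingerSq ν (fun i => p i θ) (fun i => p i θ₀) →
      sumHellingerSq ν (fun i => p i θ) (fun i => p i θ₀) ≤ ENNReal.ofReal (4 * T) →
      ∃ j, sumHellingerSq ν (fun i => p i θ) (fun i => p i (c j)) ≤ ENNReal.ofReal (T / 100)

variable {ν : Measure Y} {s : ℕ} {p : Fin s → Θ → Y → ℝ≥0}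

namespace IsExperiment

lemma sumHellingerSq_le (hp : IsExperiment ν p) (θ θ' : Θ) :
    sumHellingerSq ν (fun i => p i θ) (fun i => p i θ') ≤ ENNReal.ofReal (2 * s) := by
  have h : ∀ i, hellingerSq ν (p i θ) (p i θ') ≤ 2 := by
    intro i
    have hpt : ∀ y, ENNReal.ofReal ((√(p i θ y : ℝ) - √(p i θ' y : ℝ)) ^ 2)
        ≤ (p i θ y : ℝ≥0∞) + p i θ' y := by
      intro y
      rw [← ENNReal.coe_add, ← ENNReal.ofReal_coe_nnreal]
      refine ENNReal.ofReal_le_ofReal ?_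
      have h1 := Real.sq_sqrt (NNReal.coe_nonneg (p i θ y))
      have h2 := Real.sq_sqrt (NNReal.coe_nonneg (p i θ' y))
      push_cast
      nlinarith [mul_nonneg (Real.sqrt_nonneg (p i θ y : ℝ)) (Real.sqrt_nonneg (p i θ' y : ℝ))]
    refine (lintegral_mono hpt).trans ?_
    rw [lintegral_add_left (hp.measurable_density i θ).coe_nnreal_ennreal,
      hp.lintegral_eq_one, hp.lintegral_eq_one]
    norm_num
  calc _ ≤ ∑ _i : Fin s, (2 : ℝ≥0∞) := Finset.sum_le_sum fun i _ => h i
    _ = _ := by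
      rw [ENNReal.ofReal_mul (by norm_num)]
      simp [mul_comm]

/-- Peeling: radii double from shell to shell, and the total squared distance never exceeds `2s`, so
`J` shells exhaust the complement of the ball. Each is charged the bound of the innermost one, hence
the factor `J`. -/
lemma sampleLaw_outside_ball_le [SFinite ν] (hp : IsExperiment ν p) (θ₀ : Θ) (prior : Measure Θ)
    [IsProbabilityMeasure prior] {T : ℝ} (hT : 0 ≤ T) {J : ℕ} (hJ : 2 * (s : ℝ) ≤ 4 ^ J * T)
    (hcov : ∀ j < J, HasShellCover ν p θ₀ (4 ^ j * T)) :
    sampleLaw ν p θ₀ {D | ENNReal.ofReal (J * Real.exp (-T / 96))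
        < ∫⁻ θ in {θ | ENNReal.ofReal T < sumHellingerSq ν (fun i => p i θ) (fun i => p i θ₀)},
          likelihoodRatio p θ₀ θ D ∂prior}
      ≤ ENNReal.ofReal (2 * J * Real.exp (-T / 96)) := by
  set P := sampleLaw ν p θ₀ with hP
  let d : Θ → ℝ≥0∞ := fun θ => sumHellingerSq ν (fun i => p i θ) (fun i => p i θ₀)
  let A : ℕ → Set Θ := fun j =>
    {θ | ENNReal.ofReal (4 ^ j * T) < d θ ∧ d θ ≤ ENNReal.ofReal (4 * (4 ^ j * T))}
  have hsub : {θ | ENNReal.ofReal T < d θ} ⊆ ⋃ j : Fin J, A j := by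
    intro θ (hθ : ENNReal.ofReal T < d θ)
    have hex : ∃ j, d θ ≤ ENNReal.ofReal (4 ^ j * T) :=
      ⟨J, (hp.sumHellingerSq_le θ θ₀).trans (ENNReal.ofReal_le_ofReal hJ)⟩
    classical
    have hspec := Nat.find_spec hex
    obtain ⟨j, hj⟩ : ∃ j, Nat.find hex = j + 1 := by
      refine Nat.exists_eq_succ_of_ne_zero fun h0 => ?_
      rw [h0] at hspec
      simp only [pow_zero, one_mul] at hspec
      exact absurd hθ (not_lt.2 hspec)
    have hjJ : j < J := by
      have : Nat.find hex ≤ J :=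
        Nat.find_min' hex ((hp.sumHellingerSq_le θ θ₀).trans (ENNReal.ofReal_le_ofReal hJ))
      omega
    have hmin := Nat.find_min hex (show j < Nat.find hex by omega)
    rw [hj, pow_succ] at hspec
    refine Set.mem_iUnion.2 ⟨⟨j, hjJ⟩, not_le.1 hmin, hspec.trans_eq ?_⟩
    congr 1; ring
  have hshell : ∀ j : Fin J, P {D | ENNReal.ofReal (Real.exp (-T / 96))
        < ∫⁻ θ in A j, likelihoodRatio p θ₀ θ D ∂prior}
      ≤ ENNReal.ofReal (2 * Real.exp (-T / 96)) := by
    intro j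
    obtain ⟨N, c, hN, hc, hA⟩ := hcov j j.2
    have hTj : T ≤ 4 ^ (j : ℕ) * T := le_mul_of_one_le_left hT (one_le_pow₀ (by norm_num))
    have hexp : Real.exp (-(4 ^ (j : ℕ) * T) / 96) ≤ Real.exp (-T / 96) :=
      Real.exp_le_exp.2 (by linarith)
    refine (measure_mono fun D hD => ?_).trans
      ((hp.sampleLaw_shell_le θ₀ prior (hT.trans hTj) hN c hc
        (A := A j) fun θ hθ => hA θ hθ.1 hθ.2).trans (ENNReal.ofReal_le_ofReal ?_))
    · exact (ENNReal.ofReal_le_ofReal hexp).trans_lt hD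
    · gcongr
  have hcover : {D | ENNReal.ofReal (J * Real.exp (-T / 96))
        < ∫⁻ θ in {θ | ENNReal.ofReal T < d θ}, likelihoodRatio p θ₀ θ D ∂prior} ⊆
      ⋃ j : Fin J, {D | ENNReal.ofReal (Real.exp (-T / 96))
        < ∫⁻ θ in A j, likelihoodRatio p θ₀ θ D ∂prior} := by
    intro D hD
    by_contra hcon
    rw [Set.mem_ofPred_eq] at hD
    simp only [Set.mem_iUnion, Set.mem_ofPred_eq, not_exists, not_lt] at hcon
    refine absurd hD (not_lt.2 ?_)
    calc _ ≤ ∫⁻ θ in ⋃ j : Fin J, A j, likelihoodRatio p θ₀ θ D ∂prior := lintegral_mono_set hsub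
      _ ≤ ∑' j : Fin J, ∫⁻ θ in A j, likelihoodRatio p θ₀ θ D ∂prior := lintegral_iUnion_le _ _
      _ = ∑ j : Fin J, ∫⁻ θ in A j, likelihoodRatio p θ₀ θ D ∂prior := tsum_fintype _
      _ ≤ ∑ _j : Fin J, ENNReal.ofReal (Real.exp (-T / 96)) :=
          Finset.sum_le_sum fun j _ => hcon j
      _ = _ := by
          rw [ENNReal.ofReal_mul (by positivity)]
          simp
  refine (measure_mono hcover).trans ((measure_iUnion_fintype_le _ _).trans ?_)
  refine (Finset.sum_le_sum fun j _ => hshell j).trans_eq ?_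
  rw [mul_right_comm, mul_comm _ (J : ℝ), ENNReal.ofReal_mul (by positivity)]
  simp

/-- The evidence is bounded below with high probability if the prior charges the set of
parameters whose likelihood ratios have controlled exponential moments. -/
lemma sampleLaw_evidence_lt_le (hp : IsExperiment ν p) (θ₀ : Θ) (prior : Measure Θ)
    [IsProbabilityMeasure prior] {B : Set Θ} (hB0 : prior B ≠ 0) {κ a : ℝ} (hκ : 0 < κ)
    (ha : 0 ≤ a)
    (hB : ∀ θ ∈ B, ∑ i, ∫⁻ y, (max ((p i θ₀ y : ℝ≥0∞) / p i θ y) 1) ^ κ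
      ∂(ν.withDensity fun y => (p i θ₀ y : ℝ≥0∞)) ≤ s + ENNReal.ofReal a) (t : ℝ) :
    sampleLaw ν p θ₀ {D | ∫⁻ θ, likelihoodRatio p θ₀ θ D ∂prior
        < ENNReal.ofReal (Real.exp (-t) / 2) * prior B}
      ≤ ENNReal.ofReal (2 * Real.exp (a - κ * t)) := by
  have := hp.isProbabilityMeasure_sampleLaw θ₀
  have hwd := hp.isProbabilityMeasure_withDensity θ₀
  have hd := hp.measurable_density
  have hm := hp.measurable_likelihoodRatio θ₀
  set P := sampleLaw ν p θ₀ with hP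
  have hBtop : prior B ≠ ⊤ := measure_ne_top _ _
  let w : Fin s → Θ → Y → ℝ≥0∞ := fun i θ y => max ((p i θ₀ y : ℝ≥0∞) / p i θ y) 1
  have hw : ∀ i, Measurable fun z : Θ × Y => w i z.1 z.2 := fun i =>
    (((hd i θ₀).comp measurable_snd).coe_nnreal_ennreal.div
      (hp.measurable i).coe_nnreal_ennreal).max measurable_const
  let W : Θ → (Fin s → Y) → ℝ≥0∞ := fun θ D => ∏ i, w i θ (D i) ^ κ
  have hW : Measurable fun z : Θ × (Fin s → Y) => W z.1 z.2 :=
    Finset.measurable_prod _ fun i _ => ((hw i).comp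
      (measurable_fst.prodMk ((measurable_pi_apply i).comp measurable_snd))).pow_const κ
  have hEW : ∀ θ ∈ B, ∫⁻ D, W θ D ∂P ≤ ENNReal.ofReal (Real.exp a) := by
    intro θ hθ
    rw [hP]
    unfold sampleLaw
    rw [lintegral_pi_prod _ (φ := fun i y => w i θ y ^ κ)
      fun i => ((hw i).comp measurable_prodMk_left).pow_const κ]
    refine (ENNReal.prod_le_ofReal_exp _ le_rfl ha ?_).trans (by rw [sub_zero])
    simpa using hB θ hθ
  let V : (Fin s → Y) → ℝ≥0∞ := fun D => ∫⁻ θ in B, W θ D ∂prior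
  have hVm : Measurable V := Measurable.lintegral_prod_left' (μ := prior.restrict B) hW
  have hV : ∫⁻ D, V D ∂P ≤ ENNReal.ofReal (Real.exp a) * prior B := by
    rw [lintegral_lintegral_swap (f := fun D θ => W θ D) (hW.comp measurable_swap).aemeasurable,
      ← setLIntegral_const]
    exact setLIntegral_mono measurable_const hEW
  have hcover : P {D | ∫⁻ θ, likelihoodRatio p θ₀ θ D ∂prior
        < ENNReal.ofReal (Real.exp (-t) / 2) * prior B}
      ≤ P {D | ENNReal.ofReal (Real.exp (κ * t) / 2) * prior B ≤ V D} := by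
    refine measure_mono_ae ?_
    filter_upwards [hp.ae_density_ne_zero θ₀] with D hD
      (hlt : ∫⁻ θ, likelihoodRatio p θ₀ θ D ∂prior < _)
    by_contra hcon
    replace hcon : V D < ENNReal.ofReal (Real.exp (κ * t) / 2) * prior B := not_le.1 hcon
    -- Either the product of truncated ratios is at most `exp t`, and the likelihood ratio is at
    -- least `exp (-t)`, or its power `W` is at least `exp (κ t)`. Integrated over `B`, this shows
    -- that a small evidence forces a large `V`.
    have hpt : ∀ θ, 1 ≤ ENNReal.ofReal (Real.exp t) * likelihoodRatio p θ₀ θ D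
        + ENNReal.ofReal (Real.exp (-(κ * t))) * W θ D := by
      intro θ
      have hLR : (∏ i, w i θ (D i))⁻¹ ≤ likelihoodRatio p θ₀ θ D := by
        rw [ENNReal.prod_inv_distrib]
        · refine Finset.prod_le_prod' fun i _ => ?_
          rw [← ENNReal.inv_div (Or.inl ENNReal.coe_ne_top)
            (Or.inr (by exact_mod_cast hD i)), ENNReal.inv_le_inv]
          exact le_max_left _ _
        · intro i _ j _ _
          exact Or.inl (zero_lt_one.trans_le (le_max_right _ _)).ne'
      have hWp : W θ D = (∏ i, w i θ (D i)) ^ κ := ENNReal.prod_rpow_of_nonneg hκ.le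
      rcases le_total (∏ i, w i θ (D i)) (ENNReal.ofReal (Real.exp t)) with h | h
      · refine le_add_right ?_
        calc (1 : ℝ≥0∞) = ENNReal.ofReal (Real.exp t) * (ENNReal.ofReal (Real.exp t))⁻¹ :=
              (ENNReal.mul_inv_cancel (ENNReal.ofReal_pos.2 (Real.exp_pos _)).ne'
                ENNReal.ofReal_ne_top).symm
          _ ≤ _ := by
              gcongr
              exact (ENNReal.inv_le_inv.2 h).trans hLR
      · refine le_add_left ?_
        rw [hWp]
        calc (1 : ℝ≥0∞) = ENNReal.ofReal (Real.exp (-(κ * t))) *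
              ENNReal.ofReal (Real.exp t) ^ κ := by
              rw [ENNReal.ofReal_rpow_of_pos (Real.exp_pos _), ← Real.exp_mul,
                ← ENNReal.ofReal_mul (Real.exp_pos _).le, ← Real.exp_add]
              simp [mul_comm]
          _ ≤ _ := by gcongr
    have hint : prior B ≤ ENNReal.ofReal (Real.exp t) * ∫⁻ θ, likelihoodRatio p θ₀ θ D ∂prior
        + ENNReal.ofReal (Real.exp (-(κ * t))) * V D := by
      have hmθ : Measurable fun θ => likelihoodRatio p θ₀ θ D := hm.comp measurable_prodMk_right
      calc prior B = ∫⁻ _ in B, 1 ∂prior := by simp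
        _ ≤ ∫⁻ θ in B, (ENNReal.ofReal (Real.exp t) * likelihoodRatio p θ₀ θ D
            + ENNReal.ofReal (Real.exp (-(κ * t))) * W θ D) ∂prior := lintegral_mono fun θ => hpt θ
        _ = ENNReal.ofReal (Real.exp t) * ∫⁻ θ in B, likelihoodRatio p θ₀ θ D ∂prior
            + ENNReal.ofReal (Real.exp (-(κ * t))) * V D := by
            rw [lintegral_add_left (by fun_prop), lintegral_const_mul' _ _ ENNReal.ofReal_ne_top,
              lintegral_const_mul' _ _ ENNReal.ofReal_ne_top]
        _ ≤ _ := by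
            gcongr
            exact Measure.restrict_le_self
    have h1 : ENNReal.ofReal (Real.exp t) * (ENNReal.ofReal (Real.exp (-t) / 2) * prior B)
        = prior B / 2 := by
      rw [← mul_assoc, ← ENNReal.ofReal_mul (Real.exp_pos _).le, ← mul_div_assoc, ← Real.exp_add,
        add_neg_cancel, Real.exp_zero, ENNReal.ofReal_div_of_pos (by norm_num), mul_comm,
        ENNReal.ofReal_one, ENNReal.ofReal_ofNat, mul_one_div]
    have h2 : ENNReal.ofReal (Real.exp (-(κ * t))) *
        (ENNReal.ofReal (Real.exp (κ * t) / 2) * prior B) = prior B / 2 := by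
      rw [← mul_assoc, ← ENNReal.ofReal_mul (Real.exp_pos _).le, ← mul_div_assoc, ← Real.exp_add,
        neg_add_cancel, Real.exp_zero, ENNReal.ofReal_div_of_pos (by norm_num), mul_comm,
        ENNReal.ofReal_one, ENNReal.ofReal_ofNat, mul_one_div]
    have hlt1 : ENNReal.ofReal (Real.exp t) * ∫⁻ θ, likelihoodRatio p θ₀ θ D ∂prior
        < prior B / 2 := by
      rw [← h1]
      exact ENNReal.mul_lt_mul_right (ENNReal.ofReal_pos.2 (Real.exp_pos _)).ne'
        ENNReal.ofReal_ne_top hlt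
    have hlt2 : ENNReal.ofReal (Real.exp (-(κ * t))) * V D < prior B / 2 := by
      rw [← h2]
      exact ENNReal.mul_lt_mul_right (ENNReal.ofReal_pos.2 (Real.exp_pos _)).ne'
        ENNReal.ofReal_ne_top hcon
    have := hint.trans_lt (ENNReal.add_lt_add hlt1 hlt2)
    rw [ENNReal.add_halves] at this
    exact lt_irrefl _ this
  refine hcover.trans ?_
  -- Markov's inequality for `V`; the prior mass of `B` occurs in both mean and level, and cancels.
  have hc0 : ENNReal.ofReal (Real.exp (κ * t) / 2) * prior B ≠ 0 :=
    mul_ne_zero (ENNReal.ofReal_pos.2 (by positivity)).ne' hB0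
  refine (meas_ge_le_lintegral_div hVm.aemeasurable hc0
    (ENNReal.mul_ne_top ENNReal.ofReal_ne_top hBtop)).trans ?_
  refine ENNReal.div_le_of_le_mul (hV.trans_eq ?_)
  rw [← mul_assoc, ← ENNReal.ofReal_mul (by positivity)]
  congr 2
  rw [mul_div_assoc', mul_right_comm, mul_assoc 2, ← Real.exp_add]
  ring_nf

/-- Dividing the likelihood by its value at `θ₀`, positive and finite here, leaves Bayes' rule
unchanged. -/
lemma posterior_eq (hp : IsExperiment ν p) (prior : Measure Θ) {θ₀ : Θ} {D : Fin s → Y}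
    (hD : ∀ i, p i θ₀ (D i) ≠ 0) :
    posterior prior p D = (∫⁻ θ, likelihoodRatio p θ₀ θ D ∂prior)⁻¹ •
      prior.withDensity fun θ => likelihoodRatio p θ₀ θ D := by
  have hmθ : Measurable fun θ => likelihoodRatio p θ₀ θ D :=
    (hp.measurable_likelihoodRatio θ₀).comp measurable_prodMk_right
  set c : ℝ≥0∞ := ∏ i, (p i θ₀ (D i) : ℝ≥0∞) with hc
  have hc0 : c ≠ 0 := Finset.prod_ne_zero_iff.2 fun i _ => by exact_mod_cast hD i
  have hct : c ≠ ⊤ := ENNReal.prod_ne_top fun i _ => ENNReal.coe_ne_top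
  have e : (fun θ => ∏ i, (p i θ (D i) : ℝ≥0∞)) = fun θ => c * likelihoodRatio p θ₀ θ D := by
    ext θ
    rw [hc, likelihoodRatio, ← Finset.prod_mul_distrib]
    refine Finset.prod_congr rfl fun i _ => ?_
    rw [ENNReal.mul_div_cancel (by exact_mod_cast hD i) ENNReal.coe_ne_top]
  unfold posterior
  rw [e, lintegral_const_mul' _ _ hct]
  have : (fun θ => c * likelihoodRatio p θ₀ θ D) = c • fun θ => likelihoodRatio p θ₀ θ D := rfl
  rw [this, withDensity_smul _ hmθ, smul_smul,
    ENNReal.mul_inv (Or.inl hc0) (Or.inl hct), mul_right_comm,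
    ENNReal.inv_mul_cancel hc0 hct, one_mul]

lemma isProbabilityMeasure_posterior (hp : IsExperiment ν p) (prior : Measure Θ) {θ₀ : Θ}
    {D : Fin s → Y} (hD : ∀ i, p i θ₀ (D i) ≠ 0)
    (h0 : ∫⁻ θ, likelihoodRatio p θ₀ θ D ∂prior ≠ 0)
    (ht : ∫⁻ θ, likelihoodRatio p θ₀ θ D ∂prior ≠ ⊤) :
    IsProbabilityMeasure (posterior prior p D) := by
  refine ⟨?_⟩
  rw [hp.posterior_eq prior hD, Measure.smul_apply, withDensity_apply _ .univ, setLIntegral_univ,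
    smul_eq_mul, ENNReal.inv_mul_cancel h0 ht]

lemma lintegral_posterior_le (hp : IsExperiment ν p) (prior : Measure Θ) {θ₀ : Θ}
    {D : Fin s → Y} (hD : ∀ i, p i θ₀ (D i) ≠ 0) {F : Θ → ℝ≥0∞} (hF : Measurable F)
    {U : Set Θ} (hU : MeasurableSet U) {a b : ℝ≥0∞} (ha : ∀ θ ∉ U, F θ ≤ a)
    (hb : ∀ θ, F θ ≤ b) :
    ∫⁻ θ, F θ ∂(posterior prior p D) ≤ a + b * ((∫⁻ θ, likelihoodRatio p θ₀ θ D ∂prior)⁻¹ *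
      ∫⁻ θ in U, likelihoodRatio p θ₀ θ D ∂prior) := by
  have hmθ : Measurable fun θ => likelihoodRatio p θ₀ θ D :=
    (hp.measurable_likelihoodRatio θ₀).comp measurable_prodMk_right
  rw [hp.posterior_eq prior hD, lintegral_smul_measure,
    lintegral_withDensity_eq_lintegral_mul _ hmθ hF, smul_eq_mul]
  set Z := ∫⁻ θ, likelihoodRatio p θ₀ θ D ∂prior with hZ
  have hpt : ∀ θ, ((fun θ => likelihoodRatio p θ₀ θ D) * F) θ
      ≤ a * likelihoodRatio p θ₀ θ D + b * U.indicator (fun θ => likelihoodRatio p θ₀ θ D) θ := by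
    intro θ
    by_cases hθ : θ ∈ U
    · rw [Set.indicator_of_mem hθ]
      refine le_add_left ?_
      rw [Pi.mul_apply, mul_comm]
      gcongr
      exact hb θ
    · refine le_add_right ?_
      rw [Pi.mul_apply, mul_comm]
      gcongr
      exact ha θ hθ
  calc Z⁻¹ * ∫⁻ θ, ((fun θ => likelihoodRatio p θ₀ θ D) * F) θ ∂prior
      ≤ Z⁻¹ * (a * Z + b * ∫⁻ θ in U, likelihoodRatio p θ₀ θ D ∂prior) := by
        gcongr
        refine (lintegral_mono hpt).trans_eq ?_
        rw [lintegral_add_left (by fun_prop), lintegral_const_mul _ hmθ,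
          lintegral_const_mul _ (hmθ.indicator hU), lintegral_indicator hU]
    _ = a * (Z⁻¹ * Z) + b * (Z⁻¹ * ∫⁻ θ in U, likelihoodRatio p θ₀ θ D ∂prior) := by ring
    _ ≤ _ := by
        gcongr
        exact mul_le_of_le_one_right' (ENNReal.inv_mul_le_one Z)

end IsExperiment

end PosteriorBounds

/-! ### Second moments and barycenters. -/

section WassersteinBounds

variable {Θ : Type*} [MetricSpace Θ] [MeasurableSpace Θ]

lemma wasserstein_sq (μ μ' : Measure Θ) : wasserstein μ μ' ^ 2 = wassersteinSq μ μ' := by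
  unfold wasserstein
  rw [← ENNReal.rpow_mul_natCast]
  norm_num

lemma wassersteinSq_dirac_left_le (θ₀ : Θ) (μ : Measure Θ) [IsProbabilityMeasure μ] :
    wassersteinSq (Measure.dirac θ₀) μ ≤ ∫⁻ θ, edist θ θ₀ ^ 2 ∂μ := by
  refine (iInf₂_le (μ.map fun θ => (θ₀, θ)) (And.intro ?_ ?_)).trans
    ((lintegral_map_le _ _).trans_eq (by simp_rw [edist_comm θ₀]))
  · rw [Measure.map_map measurable_fst (by fun_prop)]
    simp [Function.comp_def]
  · rw [Measure.map_map measurable_snd (by fun_prop)]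
    exact Measure.map_id

lemma wassersteinSq_dirac_right_le (θ₀ : Θ) (μ : Measure Θ) [IsProbabilityMeasure μ] :
    wassersteinSq μ (Measure.dirac θ₀) ≤ ∫⁻ θ, edist θ θ₀ ^ 2 ∂μ := by
  refine (iInf₂_le (μ.map fun θ => (θ, θ₀)) ⟨?_, ?_⟩).trans (lintegral_map_le _ _)
  · rw [Measure.map_map measurable_fst (by fun_prop)]
    exact Measure.map_id
  · rw [Measure.map_map measurable_snd (by fun_prop)]
    simp [Function.comp_def]

/-- For every coupling this is the triangle inequality with `(a + b)² ≤ 2a² + 2b²`; no optimal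
coupling is needed. -/
lemma lintegral_edist_sq_le_wassersteinSq [OpensMeasurableSpace Θ] (θ₀ : Θ) (μ μ' : Measure Θ) :
    ∫⁻ θ, edist θ θ₀ ^ 2 ∂μ ≤ 2 * wassersteinSq μ μ' + 2 * ∫⁻ θ, edist θ θ₀ ^ 2 ∂μ' := by
  have hm : Measurable fun θ : Θ => edist θ θ₀ ^ 2 := by fun_prop
  -- Isolating the infimum allows an argument coupling by coupling.
  rw [← tsub_le_iff_right, mul_comm 2 (wassersteinSq μ μ'), ← ENNReal.div_le_iff (by norm_num) (by norm_num)]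
  refine le_iInf₂ fun π hπ => ?_
  rw [ENNReal.div_le_iff (by norm_num) (by norm_num), mul_comm _ (2 : ℝ≥0∞), tsub_le_iff_right]
  calc ∫⁻ θ, edist θ θ₀ ^ 2 ∂μ = ∫⁻ z, edist z.1 θ₀ ^ 2 ∂π := by
        rw [← hπ.1, lintegral_map hm measurable_fst]
    _ ≤ ∫⁻ z, (2 * edist z.1 z.2 ^ 2 + 2 * edist z.2 θ₀ ^ 2) ∂π := by
        refine lintegral_mono fun z => ?_
        calc edist z.1 θ₀ ^ 2 ≤ (edist z.1 z.2 + edist z.2 θ₀) ^ 2 := by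
              gcongr; exact edist_triangle _ _ _
          _ ≤ 2 * (edist z.1 z.2 ^ 2 + edist z.2 θ₀ ^ 2) := by
              rcases eq_or_ne (edist z.1 z.2) ⊤ with h | h
              · simp [h]
              rcases eq_or_ne (edist z.2 θ₀) ⊤ with h' | h'
              · simp [h']
              lift edist z.1 z.2 to ℝ≥0 using h with a
              lift edist z.2 θ₀ to ℝ≥0 using h' with b
              norm_cast
              rw [← NNReal.coe_le_coe]
              push_cast
              nlinarith [sq_nonneg ((a : ℝ) - b)]
          _ = _ := by ring
    _ = 2 * ∫⁻ z, edist z.1 z.2 ^ 2 ∂π + 2 * ∫⁻ θ, edist θ θ₀ ^ 2 ∂μ' := by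
        rw [lintegral_add_right _ (by fun_prop), lintegral_const_mul' _ _ (by norm_num),
          lintegral_const_mul' _ _ (by norm_num), ← hπ.2, lintegral_map hm measurable_snd]

/-- Testing optimality against the Dirac mass at `θ₀` bounds the mean squared distance to the
clients by `B`; the triangle inequality then gives `2B + 2B`. -/
lemma IsWassersteinBarycenter.lintegral_edist_sq_le [OpensMeasurableSpace Θ] {K : ℕ} (hK : 0 < K)
    {μ : Fin K → Measure Θ} {b : Measure Θ} (hb : IsWassersteinBarycenter μ b)
    (hμ : ∀ k, IsProbabilityMeasure (μ k)) (θ₀ : Θ) {B : ℝ≥0∞}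
    (hB : ∀ k, ∫⁻ θ, edist θ θ₀ ^ 2 ∂(μ k) ≤ B) :
    ∫⁻ θ, edist θ θ₀ ^ 2 ∂b ≤ 4 * B := by
  have hK0 : (K : ℝ≥0∞) ≠ 0 := by exact_mod_cast hK.ne'
  have hKt : (K : ℝ≥0∞) ≠ ⊤ := ENNReal.natCast_ne_top K
  have h1 : ∑ k, wassersteinSq b (μ k) ≤ K * B := by
    have h := hb.2 (Measure.dirac θ₀) inferInstance
    rw [ENNReal.mul_le_mul_iff_right (ENNReal.inv_ne_zero.2 hKt) (ENNReal.inv_ne_top.2 hK0)] at h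
    simp only [wasserstein_sq] at h
    refine h.trans ((Finset.sum_le_sum fun k _ =>
      (have := hμ k; wassersteinSq_dirac_left_le θ₀ (μ k)).trans (hB k)).trans_eq ?_)
    simp
  have h2 : (K : ℝ≥0∞) * ∫⁻ θ, edist θ θ₀ ^ 2 ∂b ≤ K * (4 * B) := by
    calc (K : ℝ≥0∞) * ∫⁻ θ, edist θ θ₀ ^ 2 ∂b
        = ∑ _k : Fin K, ∫⁻ θ, edist θ θ₀ ^ 2 ∂b := by simp
      _ ≤ ∑ k, (2 * wassersteinSq b (μ k) + 2 * B) := Finset.sum_le_sum fun k _ =>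
          (lintegral_edist_sq_le_wassersteinSq θ₀ b (μ k)).trans (by gcongr; exact hB k)
      _ = 2 * ∑ k, wassersteinSq b (μ k) + 2 * (K * B) := by
          rw [Finset.sum_add_distrib, ← Finset.mul_sum]
          simp; ring
      _ ≤ 2 * (K * B) + 2 * (K * B) := by gcongr
      _ = _ := by ring
  exact (ENNReal.mul_le_mul_iff_right hK0 hKt).1 h2

end WassersteinBounds

/-! ### From brackets to Hellinger balls. -/

section Entropy

variable {Y : Type*} [MeasurableSpace Y]

lemma hellinger_sq (ν : Measure Y) (f g : Y → ℝ≥0) : hellinger ν f g ^ 2 = hellingerSq ν f g := by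
  unfold hellinger hellingerSq
  rw [← ENNReal.rpow_mul_natCast]
  norm_num

lemma pseudoHellinger_sq (ν : Measure Y) {s : ℕ} (f g : Fin s → Y → ℝ≥0) :
    pseudoHellinger ν f g ^ 2 = (s : ℝ≥0∞)⁻¹ * sumHellingerSq ν f g := by
  unfold pseudoHellinger sumHellingerSq
  rw [← ENNReal.rpow_mul_natCast]
  norm_num [hellinger_sq]

lemma pseudoHellinger_le_iff (ν : Measure Y) {s : ℕ} (hs : 0 < s) (f g : Fin s → Y → ℝ≥0)
    {r : ℝ} (hr : 0 ≤ r) : pseudoHellinger ν f g ≤ ENNReal.ofReal r ↔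
      sumHellingerSq ν f g ≤ ENNReal.ofReal (s * r ^ 2) := by
  have hs0 : (s : ℝ≥0∞) ≠ 0 := by exact_mod_cast hs.ne'
  rw [← ENNReal.pow_le_pow_left_iff two_ne_zero, pseudoHellinger_sq,
    ← ENNReal.ofReal_pow hr, ← ENNReal.mul_le_mul_iff_right hs0 (ENNReal.natCast_ne_top s),
    ← mul_assoc, ENNReal.mul_inv_cancel hs0 (ENNReal.natCast_ne_top s), one_mul,
    ENNReal.ofReal_mul (by positivity), ENNReal.ofReal_natCast]

lemma hellingerSq_le_of_bracket {ν : Measure Y} {l U f g : Y → ℝ≥0} (hlf : l ≤ᵐ[ν] f)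
    (hfU : f ≤ᵐ[ν] U) (hlg : l ≤ᵐ[ν] g) (hgU : g ≤ᵐ[ν] U) :
    hellingerSq ν f g ≤ hellingerSq ν l U := by
  refine lintegral_mono_ae ?_
  filter_upwards [hlf, hfU, hlg, hgU] with y h1 h2 h3 h4
  refine ENNReal.ofReal_le_ofReal (sq_le_sq.2 ?_)
  have h1' := Real.sqrt_le_sqrt (NNReal.coe_le_coe.2 h1)
  have h2' := Real.sqrt_le_sqrt (NNReal.coe_le_coe.2 h2)
  have h3' := Real.sqrt_le_sqrt (NNReal.coe_le_coe.2 h3)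
  have h4' := Real.sqrt_le_sqrt (NNReal.coe_le_coe.2 h4)
  rw [abs_sub_comm √(l y : ℝ), abs_of_nonneg (a := √(U y : ℝ) - √(l y : ℝ)) (by linarith), abs_le]
  constructor <;> linarith

lemma exists_hasBracketCover {ν : Measure Y} {s : ℕ} {F : Set (Fin s → Y → ℝ≥0)} {u H : ℝ}
    (h : bracketingEntropy ν F u ≤ (H : EReal)) :
    ∃ N : ℕ, (N : ℝ) ≤ Real.exp H ∧ HasBracketCover ν F u N := by
  unfold bracketingEntropy at h
  have h' := EReal.exp_monotone h
  rw [ENNReal.exp_log, EReal.exp_coe] at h'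
  have hex : ∃ N, HasBracketCover ν F u N := by
    by_contra hcon
    push Not at hcon
    simp [hcon] at h'
  classical
  refine ⟨Nat.find hex, ?_, Nat.find_spec hex⟩
  have hle : ((Nat.find hex : ℕ) : ℝ≥0∞) ≤ ENNReal.ofReal (Real.exp H) :=
    le_trans (le_iInf₂ fun N hN => by exact_mod_cast Nat.find_min' hex hN) h'
  rw [← ENNReal.ofReal_natCast] at hle
  exact (ENNReal.ofReal_le_ofReal_iff (Real.exp_pos _).le).1 hle

/-- Two members of one bracket are within its Hellinger size, so any shell point in a bracket serves
as centre for the others. Size `r/10` matches the ratio `1/100` of squared radii, and `2r` is the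
outer radius. -/
lemma hasShellCover_of_hasBracketCover {Θ : Type*} [MeasurableSpace Θ] {ν : Measure Y} {s : ℕ}
    (hs : 0 < s) {p : Fin s → Θ → Y → ℝ≥0} {θ₀ : Θ} {r : ℝ} (hr : 0 ≤ r) {N : ℕ}
    (hN : (N : ℝ) ≤ Real.exp (s * r ^ 2 / 48))
    (h : HasBracketCover ν {f | ∃ θ : Θ, (f = fun i => p i θ) ∧
      pseudoHellinger ν (fun i => p i θ) (fun i => p i θ₀) ≤ ENNReal.ofReal (2 * r)} (r / 10) N) :
    HasShellCover ν p θ₀ (s * r ^ 2) := by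
  obtain ⟨l, U, -, hlU, hcov⟩ := h
  let S : Set Θ := {θ | ENNReal.ofReal (s * r ^ 2) <
      sumHellingerSq ν (fun i => p i θ) (fun i => p i θ₀) ∧
    sumHellingerSq ν (fun i => p i θ) (fun i => p i θ₀) ≤ ENNReal.ofReal (4 * (s * r ^ 2))}
  let inBr : Fin N → Θ → Prop := fun j θ => ∀ i, l j i ≤ᵐ[ν] p i θ ∧ p i θ ≤ᵐ[ν] U j i
  rcases S.eq_empty_or_nonempty with hS | ⟨θ₁, hθ₁⟩
  · refine ⟨0, Fin.elim0, by simpa using (Real.exp_pos _).le, fun j => j.elim0,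
      fun θ h1 h2 => ?_⟩
    exact absurd (show θ ∈ S from ⟨h1, h2⟩) (by simp [hS])
  classical
  -- Brackets missing the shell get the dummy centre `θ₁`, itself in the shell so that all centres
  -- are far from `θ₀`.
  refine ⟨N, fun j => if h : ∃ θ ∈ S, inBr j θ then h.choose else θ₁, hN, fun j => ?_,
    fun θ h1 h2 => ?_⟩
  · have : (if h : ∃ θ ∈ S, inBr j θ then h.choose else θ₁) ∈ S := by
      split_ifs with h
      · exact h.choose_spec.1
      · exact hθ₁
    refine this.1.le.trans_eq ?_
    unfold sumHellingerSq hellingerSq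
    refine Finset.sum_congr rfl fun i _ => lintegral_congr fun y => ?_
    congr 1; ring
  · obtain ⟨j, hj⟩ := hcov (fun i => p i θ) ⟨θ, rfl, by
      rw [pseudoHellinger_le_iff ν hs _ _ (by positivity)]
      refine h2.trans_eq ?_
      congr 1; ring⟩
    have hex : ∃ θ ∈ S, inBr j θ := ⟨θ, ⟨h1, h2⟩, hj⟩
    refine ⟨j, ?_⟩
    simp only [dif_pos hex]
    have hc := hex.choose_spec.2
    calc _ ≤ sumHellingerSq ν (l j) (U j) := Finset.sum_le_sum fun i _ =>
          hellingerSq_le_of_bracket (hj i).1 (hj i).2 (hc i).1 (hc i).2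
      _ ≤ ENNReal.ofReal (s * (r / 10) ^ 2) :=
          (pseudoHellinger_le_iff ν hs _ _ (by positivity)).1 (hlU j)
      _ = _ := by congr 1; ring

end Entropy

/-! ### Entropy bounds from the integral condition. -/

section EntropyGrowth

/-- The entropy integral bounds the entropy itself at any fixed multiple of the radius. -/
lemma le_of_entropy_integral_lt {C₁ C₂ δ R x : ℝ} {ψ : ℝ → ℝ} (hδ : 0 < δ) (hδC : δ ≤ C₁)
    (hC₂ : 0 < C₂) (hR : 0 < R) (hR' : C₁ * R / 2 ^ 12 ≤ δ / 2) (hx : 0 ≤ x)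
    (hpos : ∀ u, 0 < u → 0 < ψ u) (hanti : AntitoneOn ψ (Set.Ioi 0))
    (hint : ∫ u in (C₁ * R ^ 2 / 2 ^ 12)..(C₁ * R), √(ψ u) < C₂ * √x * R ^ 2) :
    ψ (δ * R) ≤ (2 * C₂ / δ) ^ 2 * (x * R ^ 2) := by
  have hC₁ : 0 < C₁ := hδ.trans_le hδC
  set a := C₁ * R ^ 2 / 2 ^ 12 with ha
  have ha0 : 0 < a := by positivity
  have haδ : a ≤ δ * R / 2 := by
    calc a = C₁ * R / 2 ^ 12 * R := by rw [ha]; ring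
      _ ≤ δ / 2 * R := by gcongr
      _ = _ := by ring
  have hδR : 0 < δ * R := by positivity
  have hδCR : δ * R ≤ C₁ * R := by gcongr
  have hanti' : AntitoneOn (fun u => √(ψ u)) (Set.Ioi 0) := fun u hu v hv huv =>
    Real.sqrt_le_sqrt (hanti hu hv huv)
  have hii : ∀ y z, 0 < y → y ≤ z →
      IntervalIntegrable (fun u => √(ψ u)) volume y z := by
    intro y z hy hyz
    refine (hanti'.mono ?_).intervalIntegrable
    rw [Set.uIcc_of_le hyz]
    exact fun w hw => hy.trans_le hw.1
  -- The integrand decreases, so its right-end value is a lower bound on `[a, δR]`, whose length is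
  -- at least `δR/2`.
  have h1 : (δ * R - a) * √(ψ (δ * R)) ≤ ∫ u in a..(δ * R), √(ψ u) := by
    have := intervalIntegral.integral_mono_on (a := a) (b := δ * R) (by linarith)
      (intervalIntegrable_const (c := √(ψ (δ * R)))) (hii _ _ ha0 (by linarith))
      fun u hu => hanti' (show (0 : ℝ) < u from ha0.trans_le hu.1) hδR hu.2
    simpa using this
  have h2 : ∫ u in a..(δ * R), √(ψ u) ≤ ∫ u in a..(C₁ * R), √(ψ u) := by
    rw [← intervalIntegral.integral_add_adjacent_intervals (hii a (δ * R) ha0 (by linarith))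
      (hii (δ * R) (C₁ * R) hδR hδCR)]
    have := intervalIntegral.integral_nonneg (μ := volume) hδCR
      fun u _ => Real.sqrt_nonneg (ψ u)
    linarith
  have h3 : δ * R / 2 * √(ψ (δ * R)) ≤ C₂ * √x * R ^ 2 := by
    have : δ * R / 2 * √(ψ (δ * R)) ≤ (δ * R - a) * √(ψ (δ * R)) := by
      gcongr; linarith
    linarith
  have h4 : √(ψ (δ * R)) ≤ 2 * C₂ / δ * (√x * R) := by
    have e : 2 * C₂ / δ * (√x * R) = C₂ * √x * R ^ 2 / (δ * R / 2) := by
      field_simp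
    rw [e, le_div_iff₀ (by positivity)]
    linarith
  calc ψ (δ * R) = √(ψ (δ * R)) ^ 2 := (Real.sq_sqrt (hpos _ hδR).le).symm
    _ ≤ (2 * C₂ / δ * (√x * R)) ^ 2 := by gcongr
    _ = _ := by rw [mul_pow, mul_pow, Real.sq_sqrt hx]

/-- Since the entropy bound does not depend on the sample size, applying the integral condition at
a smaller sample size improves the constant. -/
lemma eventually_entropy_le {C₁ C₂ : ℝ} {Ψ : ℝ → ℝ → ℝ} (hC₁ : 0 < C₁) (hC₂ : 0 < C₂)
    (hpos : ∀ u r, 0 < u → 0 < r → 0 < Ψ u r)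
    (hanti : ∀ r, 0 < r → AntitoneOn (fun u => Ψ u r) (Set.Ioi 0))
    (hmono : ∀ u, 0 < u → MonotoneOn (fun r => Ψ u r) (Set.Ioi 0))
    (hint : ∀ᶠ s : ℕ in atTop, ∀ r : ℝ, Real.log s / √(s : ℝ) ≤ r →
      ∫ u in (C₁ * r ^ 2 / 2 ^ 12)..(C₁ * r), √(Ψ u r) < C₂ * √(s : ℝ) * r ^ 2) (A : ℝ) :
    ∃ M : ℝ, A ≤ M ∧ 1 ≤ M ∧ ∀ᶠ s : ℕ in atTop, ∀ r : ℝ, 0 < r →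
      M * (Real.log s / √(s : ℝ)) ≤ r → r ≤ 2 → Ψ (r / 10) (2 * r) ≤ s * r ^ 2 / 48 := by
  -- `δ ≤ C₁` keeps `δR` inside the integration range; `δ ≤ 1/20` gives `δ (2r) ≤ r/10`.
  set δ := min C₁ (1 / 20) with hδ
  have hδ0 : 0 < δ := lt_min hC₁ (by norm_num)
  have hδC : δ ≤ C₁ := min_le_left _ _
  have hδ20 : δ ≤ 1 / 20 := min_le_right _ _
  set Q := (2 * C₂ / δ) ^ 2 with hQ
  have hQ0 : 0 < Q := by positivity
  -- The largest radius for which the lower limit of integration stays below half of `δR`.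
  set R₁ := 2 ^ 11 * δ / C₁ with hR₁
  have hR₁0 : 0 < R₁ := by positivity
  -- `384 = 48 · 2 · 4`: the target `1/48`, the rounding loss in `s' ≤ 2s/M²`, and the square of
  -- `2r`.
  set M := max (max A 1) (384 * Q) with hM
  have hM1 : 1 ≤ M := (le_max_right A 1).trans (le_max_left _ _)
  have hM0 : 0 < M := by linarith
  have hMQ : 384 * Q ≤ M ^ 2 := by
    have : 384 * Q ≤ M := le_max_right _ _
    nlinarith
  refine ⟨M, (le_max_left A 1).trans (le_max_left _ _), hM1, ?_⟩
  obtain ⟨s₀, hs₀⟩ := eventually_atTop.1 hint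
  have hbig : ∀ x : ℝ, ∀ᶠ s : ℕ in atTop, x ≤ s := fun x =>
    tendsto_natCast_atTop_atTop.eventually_ge_atTop x
  filter_upwards [hbig (M ^ 2 * s₀), hbig (M ^ 2), hbig 1,
    hbig (192 * Ψ (R₁ / 20) 4 / R₁ ^ 2)] with s hs1 hs2 hs3 hs4 r hr hrM hr2
  have hs0 : (0 : ℝ) < s := by linarith
  rcases le_total (2 * r) R₁ with hrR | hrR
  -- The condition at sample size `s'` applies at radius `2r`, since `log s' / √s' ≤ M log s / √s ≤
  -- r`, and its right side is smaller by a factor of order `M` than at `s`.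
  · set s' := ⌈(s : ℝ) / M ^ 2⌉₊ with hs'
    have hM2 : (0 : ℝ) < M ^ 2 := by positivity
    have hge : (s : ℝ) / M ^ 2 ≤ s' := Nat.le_ceil _
    have hs'pos : (0 : ℝ) < s' := (by positivity : (0 : ℝ) < (s : ℝ) / M ^ 2).trans_le hge
    have hlt : (s' : ℝ) < s / M ^ 2 + 1 := Nat.ceil_lt_add_one (by positivity)
    have hle2 : (s' : ℝ) ≤ 2 * (s / M ^ 2) := by
      have : 1 ≤ (s : ℝ) / M ^ 2 := (one_le_div hM2).2 hs2
      linarith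
    have hles : s' ≤ s := Nat.ceil_le.2 (div_le_self hs0.le (one_le_pow₀ hM1))
    have hs₀' : s₀ ≤ s' := by
      have : (s₀ : ℝ) ≤ s' := ((le_div_iff₀ hM2).2 (by linarith)).trans hge
      exact_mod_cast this
    have hs'1 : (1 : ℝ) ≤ s' := by
      have : 0 < s' := by exact_mod_cast hs'pos
      exact_mod_cast this
    have hlog : Real.log s' / √(s' : ℝ) ≤ 2 * r := by
      have hsqrt : √(s : ℝ) / M ≤ √(s' : ℝ) := by
        refine Real.le_sqrt_of_sq_le ?_
        rw [div_pow, Real.sq_sqrt hs0.le]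
        exact hge
      have hss : 0 < √(s : ℝ) := Real.sqrt_pos.2 hs0
      calc Real.log s' / √(s' : ℝ) ≤ Real.log s / (√(s : ℝ) / M) := by
            gcongr
        _ = M * (Real.log s / √(s : ℝ)) := by field_simp
        _ ≤ 2 * r := by linarith
    have hR' : C₁ * (2 * r) / 2 ^ 12 ≤ δ / 2 := by
      calc C₁ * (2 * r) / 2 ^ 12 ≤ C₁ * R₁ / 2 ^ 12 := by gcongr
        _ = δ / 2 := by rw [hR₁]; field_simp
    have key := le_of_entropy_integral_lt hδ0 hδC hC₂ (by linarith : 0 < 2 * r) hR' hs'pos.le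
      (fun u hu => hpos u _ hu (by linarith)) (hanti _ (by linarith)) (hs₀ s' hs₀' _ hlog)
    calc Ψ (r / 10) (2 * r) ≤ Ψ (δ * (2 * r)) (2 * r) :=
          hanti _ (by linarith) (show (0 : ℝ) < δ * (2 * r) by positivity)
            (show (0 : ℝ) < r / 10 by positivity) (by nlinarith)
      _ ≤ Q * (s' * (2 * r) ^ 2) := key
      _ ≤ Q * (2 * (s / M ^ 2) * (2 * r) ^ 2) := by gcongr
      _ = (384 * Q) * (s * r ^ 2 / 48 / M ^ 2) := by ring
      _ ≤ M ^ 2 * (s * r ^ 2 / 48 / M ^ 2) := by gcongr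
      _ = _ := by field_simp
  -- For radii bounded away from zero, `Ψ` is bounded by a constant while `s r²` grows with `s`.
  · calc Ψ (r / 10) (2 * r) ≤ Ψ (R₁ / 20) (2 * r) :=
          hanti _ (by linarith) (show (0 : ℝ) < R₁ / 20 by positivity)
            (show (0 : ℝ) < r / 10 by positivity) (by linarith)
      _ ≤ Ψ (R₁ / 20) 4 := hmono _ (by positivity) (show (0 : ℝ) < 2 * r by positivity)
          (show (0 : ℝ) < 4 by norm_num) (by linarith)
      _ ≤ s * (R₁ / 2) ^ 2 / 48 := by
          rw [div_le_iff₀ (by positivity)] at hs4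
          linarith
      _ ≤ _ := by gcongr; linarith

lemma EntropyCondition.exists_hasShellCover {Θ Y : Type*} [MeasurableSpace Θ] [MeasurableSpace Y]
    {K : ℕ} {ν : Measure Y} {p : (s : ℕ) → Fin K → Fin s → Θ → Y → ℝ≥0} {θ₀ : Θ}
    (h : EntropyCondition ν p θ₀) (hp : ∀ s k, IsExperiment ν (p s k)) (A : ℝ) :
    ∃ M : ℝ, A ≤ M ∧ 1 ≤ M ∧ ∀ᶠ s : ℕ in atTop, ∀ k, ∀ r : ℝ, 0 < r →
      M * (Real.log s / √(s : ℝ)) ≤ r → HasShellCover ν (p s k) θ₀ (s * r ^ 2) := by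
  obtain ⟨C₁, C₂, Ψ, hC₁, hC₂, -, hpos, hanti, hmono, hev⟩ := h
  obtain ⟨M, hAM, hM1, hM⟩ := eventually_entropy_le hC₁ hC₂ hpos hanti hmono
    (hev.mono fun s hs => hs.2) A
  refine ⟨M, hAM, hM1, ?_⟩
  filter_upwards [hM, hev, eventually_gt_atTop 0] with s hs hes hs0 k r hr hrM
  rcases le_or_gt r 2 with hr2 | hr2
  · obtain ⟨N, hN, hcov⟩ := exists_hasBracketCover
      (hes.1 k (r / 10) (2 * r) (by positivity) (by positivity))
    exact hasShellCover_of_hasBracketCover hs0 hr.le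
      (hN.trans (Real.exp_le_exp.2 (hs r hr hrM hr2))) hcov
  -- For `r > 2` the shell is empty, as the total squared distance is at most `2s`.
  · refine ⟨0, Fin.elim0, by simpa using (Real.exp_pos _).le, fun j => j.elim0,
      fun θ h1 h2 => absurd (h1.trans_le ((hp s k).sumHellingerSq_le θ θ₀)) (not_lt.2 ?_)⟩
    refine ENNReal.ofReal_le_ofReal ?_
    rw [mul_comm]
    gcongr
    nlinarith

end EntropyGrowth

/-! ### Posterior contraction for one client. -/

section Contraction

variable {Θ Y : Type*} [MetricSpace Θ] [MeasurableSpace Θ] [OpensMeasurableSpace Θ]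
  [MeasurableSpace Y]

/-- Contraction of the posterior, in second moment around the true parameter. -/
lemma IsExperiment.sampleLaw_posterior_le {ν : Measure Y} [SFinite ν] {s : ℕ}
    {p : Fin s → Θ → Y → ℝ≥0} (hp : IsExperiment ν p) (θ₀ : Θ) (prior : Measure Θ)
    [IsProbabilityMeasure prior] {L κ c M : ℝ} {a b : ℝ≥0∞} (hL : 1 ≤ L)
    (hsL : (s : ℝ) = Real.exp L) (hκ : 0 < κ) (hc : 0 ≤ c) (hM : 96 * (c + 2 / κ + 2) ≤ M ^ 2)
    (hcov : ∀ j : ℕ, HasShellCover ν p θ₀ (4 ^ j * (M ^ 2 * L ^ 2))) {B : Set Θ}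
    (hBmass : ENNReal.ofReal (Real.exp (-c * L ^ 2)) ≤ prior B)
    (hB : ∀ θ ∈ B, ∑ i, ∫⁻ y, (max ((p i θ₀ y : ℝ≥0∞) / p i θ y) 1) ^ κ
      ∂(ν.withDensity fun y => (p i θ₀ y : ℝ≥0∞)) ≤ s + ENNReal.ofReal (L ^ 2))
    (ha : ∀ θ, sumHellingerSq ν (fun i => p i θ) (fun i => p i θ₀) ≤
      ENNReal.ofReal (M ^ 2 * L ^ 2) → edist θ θ₀ ^ 2 ≤ a)
    (hb : ∀ θ, edist θ θ₀ ^ 2 ≤ b) :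
    sampleLaw ν p θ₀ {D | ¬ (IsProbabilityMeasure (posterior prior p D) ∧
      ∫⁻ θ, edist θ θ₀ ^ 2 ∂(posterior prior p D)
        ≤ a + b * ENNReal.ofReal (2 * Real.exp (-L ^ 2)))}
      ≤ ENNReal.ofReal (4 * Real.exp (-L ^ 2)) := by
  set P := sampleLaw ν p θ₀ with hP
  set T := M ^ 2 * L ^ 2 with hT
  have hc2 : 0 ≤ 2 / κ := by positivity
  have hT1 : 1 ≤ T := by nlinarith [one_le_pow₀ hL (n := 2)]
  set U : Set Θ := {θ | ENNReal.ofReal T < sumHellingerSq ν (fun i => p i θ) (fun i => p i θ₀)}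
    with hU
  have hUm : MeasurableSet U := measurableSet_lt measurable_const
    (hp.measurable_sumHellingerSq fun i => hp.measurable_density i θ₀)
  have hB0 : prior B ≠ 0 :=
    ((ENNReal.ofReal_pos.2 (Real.exp_pos _)).trans_le hBmass).ne'
  -- One of the two spare units of `L²` in `hM` absorbs the shell count `s = exp L`; the other
  -- survives as the decay of the posterior mass.
  have hsT : s * Real.exp (-T / 96) ≤ Real.exp (-(c + 2 / κ + 1) * L ^ 2) := by
    rw [hsL, ← Real.exp_add]
    refine Real.exp_le_exp.2 ?_
    have h1 : (96 * (c + 2 / κ + 2)) * L ^ 2 ≤ T := by rw [hT]; gcongr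
    nlinarith
  -- Taking `s` shells is wasteful but enough, as `4^s ≥ 1 + 3s` and `T ≥ 1`.
  have h1 := hp.sampleLaw_outside_ball_le θ₀ prior (zero_le_one.trans hT1) (J := s) (by
    have hbern := one_add_mul_le_pow (show (-2 : ℝ) ≤ 3 by norm_num) s
    norm_num at hbern
    have hs0 : (0 : ℝ) ≤ s := Nat.cast_nonneg s
    nlinarith [one_le_pow₀ (show (1 : ℝ) ≤ 4 by norm_num) (n := s)]) fun j _ => hcov j
  -- With `t = 2L²/κ` the exponent `L² - κt` equals `-L²`.
  have h2 := hp.sampleLaw_evidence_lt_le θ₀ prior hB0 hκ (sq_nonneg L) hB (2 / κ * L ^ 2)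
  have hcover : P {D | ¬ (IsProbabilityMeasure (posterior prior p D) ∧
      ∫⁻ θ, edist θ θ₀ ^ 2 ∂(posterior prior p D)
        ≤ a + b * ENNReal.ofReal (2 * Real.exp (-L ^ 2)))} ≤
      P ({D | ENNReal.ofReal (s * Real.exp (-T / 96)) < ∫⁻ θ in U, likelihoodRatio p θ₀ θ D ∂prior}
        ∪ {D | ∫⁻ θ, likelihoodRatio p θ₀ θ D ∂prior
          < ENNReal.ofReal (Real.exp (-(2 / κ * L ^ 2)) / 2) * prior B}) := by
    refine measure_mono_ae ?_
    filter_upwards [hp.ae_density_ne_zero θ₀, hp.ae_lintegral_likelihoodRatio_lt_top θ₀ prior]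
      with D hD hfin hbad
    by_contra hcon
    refine hbad ?_
    have hcon' : ∫⁻ θ in U, likelihoodRatio p θ₀ θ D ∂prior
          ≤ ENNReal.ofReal (s * Real.exp (-T / 96)) ∧
        ENNReal.ofReal (Real.exp (-(2 / κ * L ^ 2)) / 2) * prior B
          ≤ ∫⁻ θ, likelihoodRatio p θ₀ θ D ∂prior := by
      constructor <;> by_contra hh
      · exact hcon (Or.inl (not_le.1 hh))
      · exact hcon (Or.inr (not_le.1 hh))
    obtain ⟨hnum, hden⟩ := hcon'
    set Z := ∫⁻ θ, likelihoodRatio p θ₀ θ D ∂prior with hZ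
    have hden' : ENNReal.ofReal (Real.exp (-(c + 2 / κ) * L ^ 2) / 2) ≤ Z := by
      refine le_trans ?_ hden
      calc _ = ENNReal.ofReal (Real.exp (-(2 / κ * L ^ 2)) / 2) *
            ENNReal.ofReal (Real.exp (-c * L ^ 2)) := by
            rw [← ENNReal.ofReal_mul (by positivity), div_mul_eq_mul_div, ← Real.exp_add]
            congr 3; ring
        _ ≤ _ := by gcongr
    have hpos : 0 < Real.exp (-(c + 2 / κ) * L ^ 2) / 2 := by positivity
    have hZ0 : Z ≠ 0 := ((ENNReal.ofReal_pos.2 hpos).trans_le hden').ne'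
    refine ⟨hp.isProbabilityMeasure_posterior prior hD hZ0 hfin.ne, ?_⟩
    refine (hp.lintegral_posterior_le prior hD (F := fun θ => edist θ θ₀ ^ 2) (by fun_prop) hUm
      (fun θ hθ => ha θ (not_lt.1 hθ)) hb).trans ?_
    gcongr
    calc Z⁻¹ * ∫⁻ θ in U, likelihoodRatio p θ₀ θ D ∂prior
        ≤ (ENNReal.ofReal (Real.exp (-(c + 2 / κ) * L ^ 2) / 2))⁻¹ *
          ENNReal.ofReal (Real.exp (-(c + 2 / κ + 1) * L ^ 2)) := by
          gcongr
          exact hnum.trans (ENNReal.ofReal_le_ofReal hsT)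
      _ = _ := by
          rw [← ENNReal.ofReal_inv_of_pos hpos, ← ENNReal.ofReal_mul (by positivity), inv_div,
            div_mul_eq_mul_div, mul_div_assoc, ← Real.exp_sub]
          congr 3; ring
  refine hcover.trans ((measure_union_le _ _).trans ((add_le_add h1 h2).trans ?_))
  rw [← ENNReal.ofReal_add (by positivity) (by positivity)]
  refine ENNReal.ofReal_le_ofReal ?_
  have e1 : Real.exp (-(c + 2 / κ + 1) * L ^ 2) ≤ Real.exp (-L ^ 2) :=
    Real.exp_le_exp.2 (by nlinarith [sq_nonneg L])
  have e2 : L ^ 2 - κ * (2 / κ * L ^ 2) = -L ^ 2 := by field_simp; ring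
  rw [e2]
  nlinarith

end Contraction

/-! ### Assembling the rate. -/

lemma exp_mul_max_log_eq (κ : ℝ) (x : ℝ≥0∞) :
    EReal.exp ((κ : EReal) * max (ENNReal.log x) 0) = max x 1 ^ κ := by
  rw [mul_comm, EReal.exp_mul, EReal.exp_monotone.map_max, ENNReal.exp_log, EReal.exp_zero]

/-- Identifiability turns a Hellinger bound into a bound for the metric. -/
lemma edist_sq_le_of_identifiable {Θ : Type*} [MetricSpace Θ] {θ θ' : Θ} {α CL x : ℝ} (hα : 0 < α)
    (hCL : 0 < CL) (h : CL * dist θ θ' ^ (2 * α) ≤ x) :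
    edist θ θ' ^ 2 ≤ ENNReal.ofReal ((x / CL) ^ (1 / α)) := by
  rw [edist_dist, ← ENNReal.ofReal_pow dist_nonneg]
  refine ENNReal.ofReal_le_ofReal ?_
  have h1 : dist θ θ' ^ (2 * α) ≤ x / CL := by
    rw [le_div_iff₀ hCL]; linarith
  calc dist θ θ' ^ 2 = (dist θ θ' ^ (2 * α)) ^ (1 / α) := by
        rw [← Real.rpow_mul dist_nonneg, mul_assoc, mul_one_div_cancel hα.ne', mul_one]
        norm_num
    _ ≤ _ := Real.rpow_le_rpow (by positivity) h1 (by positivity)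

theorem theorem5p2 {M K : ℕ} (hK : 0 < K)
    (Ξ : Set (EuclideanSpace ℝ (Fin M)))
    [MetricSpace (Param Ξ)] [CompactSpace (Param Ξ)]
    [MeasurableSpace (Param Ξ)] [BorelSpace (Param Ξ)]
    (θ₀ : Param Ξ) (hθ₀ : θ₀.val ∈ interior Ξ)
    {Y : Type*} [MeasurableSpace Y] (ν : Measure Y) [SigmaFinite ν]
    (p : (s : ℕ) → Fin K → Fin s → Param Ξ → Y → ℝ≥0) (hp : IsDensityFamily ν p)
    (prior : Measure (Param Ξ)) [IsProbabilityMeasure prior]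
    (α : ℝ) (hα : 0 < α)
    (hident : Identifiability ν p α)
    (hentropy : EntropyCondition ν p θ₀)
    (hprior : PriorMassCondition ν p prior θ₀)
    (hconvex : ConvexMetric Ξ)
    (pbar : (s : ℕ) → (Fin K → Fin s → Y) → Measure (Param Ξ))
    (hpbar : ∀ s, ∀ᵐ D ∂(dataLaw ν (p s) θ₀),
      IsWassersteinBarycenter (fun k => posterior prior (p s k) (D k)) (pbar s D)) :
    IsBigOP (fun s => dataLaw ν (p s) θ₀)
      (fun s D => wasserstein (pbar s D) (Measure.dirac θ₀))
      (fun s => √(Real.log s ^ (2 / α) / (s : ℝ) ^ (1 / α))) := by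
  have hexp : ∀ s k, IsExperiment ν (p s k) := fun s k =>
    ⟨fun i => (hp s k i).1, fun i => (hp s k i).2⟩
  obtain ⟨CL, hCL, hid⟩ := hident
  obtain ⟨κ, c, hκ, hc, hpr⟩ := hprior
  have hcK : 0 ≤ c * K := by positivity
  have hκ2 : 0 ≤ 2 / κ := by positivity
  obtain ⟨m, hAm, hm1, hcov⟩ :=
    hentropy.exists_hasShellCover hexp (96 * (c * K + 2 / κ + 2))
  have hm2 : 96 * (c * K + 2 / κ + 2) ≤ m ^ 2 := by nlinarith
  set d := Metric.diam (Set.univ : Set (Param Ξ)) with hd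
  have hd0 : 0 ≤ d := Metric.diam_nonneg
  have hdist : ∀ θ : Param Ξ, edist θ θ₀ ^ 2 ≤ ENNReal.ofReal (d ^ 2) := by
    intro θ
    rw [edist_dist, ← ENNReal.ofReal_pow dist_nonneg]
    refine ENNReal.ofReal_le_ofReal ?_
    gcongr
    exact Metric.dist_le_diam_of_mem isCompact_univ.isBounded trivial trivial
  -- The first term comes from the ball through identifiability; the second is the squared diameter
  -- times the residual posterior mass `2 exp (-L²) ≤ 2R`.
  set b₀ := (m ^ 2 / CL) ^ (1 / α) + 2 * d ^ 2 with hb₀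
  have hb₀pos : 0 < b₀ := by positivity
  intro ε hε
  refine ⟨√(4 * b₀), by positivity, ?_⟩
  have hlog : Tendsto (fun s : ℕ => Real.log s) atTop atTop :=
    Real.tendsto_log_atTop.comp tendsto_natCast_atTop_atTop
  have hsmall : ∀ᶠ s : ℕ in atTop, K * (4 * Real.exp (-Real.log s ^ 2)) ≤ ε := by
    have h1 : Tendsto (fun s : ℕ => Real.exp (-Real.log s ^ 2)) atTop (𝓝 0) :=
      Real.tendsto_exp_neg_atTop_nhds_zero.comp ((tendsto_pow_atTop two_ne_zero).comp hlog)
    have h2 : Tendsto (fun s : ℕ => K * (4 * Real.exp (-Real.log s ^ 2))) atTop (𝓝 0) := by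
      simpa using (h1.const_mul 4).const_mul (K : ℝ)
    exact (h2.eventually_lt_const hε).mono fun s hs => hs.le
  filter_upwards [hid, hpr, hcov, hsmall, hlog.eventually_ge_atTop 1,
    hlog.eventually_ge_atTop (1 / α), eventually_gt_atTop 0] with s hid hpr hcov hsmall hL hLα hs
  set L := Real.log s with hLdef
  have hs0 : (0 : ℝ) < s := by exact_mod_cast hs
  have hsE : (s : ℝ≥0∞) ≠ 0 := by exact_mod_cast hs.ne'
  have hsT : (s : ℝ≥0∞) ≠ ⊤ := ENNReal.natCast_ne_top s
  have hsL : (s : ℝ) = Real.exp L := (Real.exp_log hs0).symm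
  set R := L ^ (2 / α) / (s : ℝ) ^ (1 / α) with hR
  have hL0 : 0 < L := by linarith
  have hR0 : 0 < R := by positivity
  have hLR : (L ^ 2 / s) ^ (1 / α) = R := by
    rw [hR, Real.div_rpow (by positivity) hs0.le, ← Real.rpow_natCast, ← Real.rpow_mul hL0.le]
    congr 2
    push_cast
    ring
  -- Once `L ≥ 1/α`, `exp (-L²)` is below `exp (-L/α) = s^(-1/α)`.
  have hexpR : Real.exp (-L ^ 2) ≤ R := by
    calc Real.exp (-L ^ 2) ≤ Real.exp (-(L * (1 / α))) := Real.exp_le_exp.2 (by nlinarith)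
      _ = 1 / (s : ℝ) ^ (1 / α) := by
          rw [hsL, ← Real.exp_mul, Real.exp_neg, one_div (Real.exp _)]
      _ ≤ R := by
          rw [hR]
          gcongr
          exact Real.one_le_rpow hL (by positivity)
  have hclient : ∀ k, sampleLaw ν (p s k) θ₀ {D | ¬ (IsProbabilityMeasure (posterior prior (p s k) D)
      ∧ ∫⁻ θ, edist θ θ₀ ^ 2 ∂(posterior prior (p s k) D) ≤ ENNReal.ofReal (b₀ * R))}
      ≤ ENNReal.ofReal (4 * Real.exp (-L ^ 2)) := by
    intro k
    have hBmass := hpr k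
    set B := {θ | (s : ℝ≥0∞)⁻¹ * (∑ i : Fin s,
          ∫⁻ y, EReal.exp ((κ : EReal) *
              max (ENNReal.log ((p s k i θ₀ y : ℝ≥0∞) / (p s k i θ y : ℝ≥0∞))) 0)
            ∂(ν.withDensity fun y => (p s k i θ₀ y : ℝ≥0∞))) - 1
        ≤ ENNReal.ofReal (L ^ 2 / s)} with hBdef
    have hB : ∀ θ ∈ B, ∑ i, ∫⁻ y, (max ((p s k i θ₀ y : ℝ≥0∞) / p s k i θ y) 1) ^ κ
        ∂(ν.withDensity fun y => (p s k i θ₀ y : ℝ≥0∞)) ≤ s + ENNReal.ofReal (L ^ 2) := by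
      intro θ hθ
      rw [hBdef, Set.mem_ofPred_eq, tsub_le_iff_right] at hθ
      simp only [exp_mul_max_log_eq] at hθ
      rw [mul_comm, ← div_eq_mul_inv, ENNReal.div_le_iff hsE hsT] at hθ
      refine hθ.trans_eq ?_
      rw [add_mul, one_mul, add_comm, ← ENNReal.ofReal_natCast, ← ENNReal.ofReal_mul (by positivity),
        div_mul_cancel₀ _ hs0.ne']
    have hbound : ENNReal.ofReal ((m ^ 2 / CL) ^ (1 / α) * R) +
        ENNReal.ofReal (d ^ 2) * ENNReal.ofReal (2 * Real.exp (-L ^ 2))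
          ≤ ENNReal.ofReal (b₀ * R) := by
      rw [← ENNReal.ofReal_mul (by positivity), ← ENNReal.ofReal_add (by positivity) (by positivity)]
      refine ENNReal.ofReal_le_ofReal ?_
      rw [hb₀, add_mul]
      have : d ^ 2 * Real.exp (-L ^ 2) ≤ d ^ 2 * R := by gcongr
      linarith
    refine (measure_mono fun D hD => ?_).trans
      ((hexp s k).sampleLaw_posterior_le θ₀ prior (a := ENNReal.ofReal ((m ^ 2 / CL) ^ (1 / α) * R))
        (b := ENNReal.ofReal (d ^ 2)) hL hsL hκ hcK hm2 (fun j => ?_)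
        (hBmass.trans' (le_of_eq (by ring_nf))) hB (fun θ hθ => ?_) hdist)
    · rw [Set.mem_ofPred_eq] at hD ⊢
      exact fun hD' => hD ⟨hD'.1, hD'.2.trans hbound⟩
    · have hmL : 0 < m * (L / √(s : ℝ)) := by positivity
      -- This radius satisfies `s r² = 4^j m² L²`.
      have h := hcov k (2 ^ j * (m * (L / √(s : ℝ)))) (by positivity)
        (le_mul_of_one_le_left hmL.le (one_le_pow₀ (by norm_num)))
      convert h using 1
      rw [mul_pow, mul_pow, div_pow, Real.sq_sqrt hs0.le, ← pow_mul, mul_comm j 2, pow_mul]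
      field_simp
      norm_num
    · have h1 := hid k θ θ₀
      rw [pseudoHellinger_sq] at h1
      have h2 : ENNReal.ofReal (CL * dist θ θ₀ ^ (2 * α)) ≤ ENNReal.ofReal (m ^ 2 * (L ^ 2 / s)) := by
        refine h1.trans ?_
        rw [mul_comm, ← div_eq_mul_inv, ENNReal.div_le_iff hsE hsT, ← ENNReal.ofReal_natCast,
          ← ENNReal.ofReal_mul (by positivity)]
        refine hθ.trans_eq ?_
        congr 1
        field_simp
      rw [ENNReal.ofReal_le_ofReal_iff (by positivity)] at h2
      refine (edist_sq_le_of_identifiable hα hCL h2).trans_eq ?_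
      rw [mul_div_right_comm, Real.mul_rpow (by positivity) (by positivity), hLR]
  have hprob := fun k => (hexp s k).isProbabilityMeasure_sampleLaw θ₀
  have hlaw : dataLaw ν (p s) θ₀ = Measure.pi fun k => sampleLaw ν (p s k) θ₀ := rfl
  have hcover : dataLaw ν (p s) θ₀ {D | ENNReal.ofReal (√(4 * b₀) * √R)
        < wasserstein (pbar s D) (Measure.dirac θ₀)} ≤
      dataLaw ν (p s) θ₀ (⋃ k, Function.eval k ⁻¹'
        {D | ¬ (IsProbabilityMeasure (posterior prior (p s k) D) ∧
          ∫⁻ θ, edist θ θ₀ ^ 2 ∂(posterior prior (p s k) D) ≤ ENNReal.ofReal (b₀ * R))}) := by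
    refine measure_mono_ae ?_
    filter_upwards [hpbar s] with D hbar hlt
    by_contra hcon
    replace hcon : D ∉ ⋃ k, Function.eval k ⁻¹'
        {D | ¬ (IsProbabilityMeasure (posterior prior (p s k) D) ∧
          ∫⁻ θ, edist θ θ₀ ^ 2 ∂(posterior prior (p s k) D) ≤ ENNReal.ofReal (b₀ * R))} := hcon
    simp only [Set.mem_iUnion, Set.mem_preimage, Set.mem_ofPred_eq, not_exists, not_not,
      Function.eval] at hcon
    have h1 := hbar.lintegral_edist_sq_le hK (fun k => (hcon k).1) θ₀ fun k => (hcon k).2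
    have := hbar.1
    have h2 : wasserstein (pbar s D) (Measure.dirac θ₀) ^ 2
        ≤ ENNReal.ofReal (√(4 * b₀) * √R) ^ 2 := by
      rw [wasserstein_sq, ← ENNReal.ofReal_pow (by positivity), mul_pow,
        Real.sq_sqrt (by positivity), Real.sq_sqrt hR0.le]
      refine (wassersteinSq_dirac_right_le θ₀ _).trans (h1.trans_eq ?_)
      rw [mul_assoc, ENNReal.ofReal_mul (p := 4) (by norm_num), ENNReal.ofReal_ofNat]
    rw [ENNReal.pow_le_pow_left_iff two_ne_zero] at h2
    exact absurd h2 (not_le.2 hlt)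
  refine hcover.trans ((measure_iUnion_fintype_le _ _).trans ?_)
  calc _ ≤ ∑ _k : Fin K, ENNReal.ofReal (4 * Real.exp (-L ^ 2)) := by
        refine Finset.sum_le_sum fun k _ => ?_
        rw [hlaw]
        -- The client event is not shown to be measurable, so the inequality for outer measure is
        -- used.
        exact ((measurePreserving_eval (fun k => sampleLaw ν (p s k) θ₀) k).measure_preimage_le
          _).trans (hclient k)
    _ = ENNReal.ofReal (K * (4 * Real.exp (-L ^ 2))) := by
        rw [ENNReal.ofReal_mul (Nat.cast_nonneg K)]
        simp
    _ ≤ ENNReal.ofReal ε := ENNReal.ofReal_le_ofReal hsmall
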